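/- Work on the triangular lattice with horizontal lattice lines, in coordinates $(i,j)$ whose horizontal unit is half the side of a unit triangle and whose vertical unit is the height of a unit triangle; the origin is a lattice vertex, so the lattice vertices are the integer points with $i+j$ even. Let $x,n\ge 0$ be integers and let $1\le s_1<s_2<\dots<s_n\le n+x$ be integers. Consider the right trapezoidal region consisting of $2n-1$ rows of unit triangles with sides of lengths $x,2n-1,x+n,2n-1$ (north, west, south, northeast), whose base is the segment from $(0,0)$ to $(2(x+n),0)$, whose northeast side is the lattice line from $(2(x+n),0)$ to $(2x+1,2n-1)$, and whose west side is the vertical zigzag through $(0,0),(1,1),(0,2),(1,3),\dots,(1,2n-1)$ (for $n=0$ the region is empty). Let $R^1_x(s_1,\dots,s_n)$ be obtained by removing, for each $k$, the $s_k$-th up-pointing unit triangle along the base, counted from the left. A vertical lozenge (the union of two unit triangles sharing a horizontal edge) with center $(i,j)$ has weight $\frac{q^i+q^{-i}}{2}$, all other lozenges have weight $1$, the weight of a lozenge tiling is the product of the weights of its lozenges, and $\operatorname{M}(R^1_x(s_1,\dots,s_n))$ is the sum of the weights of all lozenge tilings of the region (so it is $1$ for the empty region). Put $[m]_q=1+q+\dots+q^{m-1}$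 and $[m]_q!=[1]_q[2]_q\cdots[m]_q$. Let $q$ be an element of a field in which $2\neq0$, $q\ne0$, and $[m]_{q^2}\neq 0$ for $1\le m\le 2n-2$ (for example an indeterminate, or any nonzero real number). Then $$\operatorname{M}(R^{1}_{x}(s_1,\dots,s_n))=2^{-n(n-1)}\,q^{-\sum_{i=1}^n(i-1)(4s_i-2i-1)}\,\frac{\prod_{1\le i<j\le n}[2(s_i+s_j-1)]_{q^2}\,[2(s_j-s_i)]_{q^2}}{\prod_{i=1}^{n}[2i-2]_{q^2}!}$$ $$=2^{-n(n-1)}\,q^{-\sum_{i=1}^n(i-1)(4s_i-2i-1)}\prod_{1\le i<j\le n}\frac{[2(s_i+s_j-1)]_{q^2}}{[i+j-1]_{q^2}}\prod_{1\le i<j\le n}\frac{[2(s_j-s_i)]_{q^2}}{[j-i]_{q^2}}.$$ -/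

import Mathlib

/-! The plane carries the coordinates in which half the side of a unit triangle is the horizontal
unit and the height of a unit triangle is the vertical unit. The vertices of the triangular lattice
are the integer points `(a, b)` with `a + b` even. -/

/-- A unit triangle of the triangular lattice is encoded by `(i, j)`, where `i` is the abscissa of
its vertical axis of symmetry and the triangle lies between the horizontal lines of heights `j`
and `j + 1`. If `i + j` is odd it is the up-pointing triangle with vertices
`(i - 1, j)`, `(i + 1, j)`, `(i, j + 1)`; if `i + j` is even it is the down-pointing triangle with
vertices `(i - 1, j + 1)`, `(i + 1, j + 1)`, `(i, j)`. -/
abbrev UnitTriangle := ℤ × ℤ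

/-- The up-pointing unit triangles. -/
def UnitTriangle.IsUp (t : UnitTriangle) : Prop := Odd (t.1 + t.2)

instance : DecidablePred UnitTriangle.IsUp := fun t => inferInstanceAs (Decidable (Odd (t.1 + t.2)))

/-- `(u, d)` is a lozenge: `u` is an up-pointing unit triangle and `d` is one of the three
(down-pointing) unit triangles that share an edge with `u`: the one to the left of `u`, the one to
the right of `u`, or the one below `u`. In the last case the lozenge is vertical, and its center is
the midpoint of the base of `u`, which is the point with coordinates `u`. -/
def IsLozenge (l : UnitTriangle × UnitTriangle) : Prop :=
  l.1.IsUp ∧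
    (l.2 = (l.1.1 - 1, l.1.2) ∨ l.2 = (l.1.1 + 1, l.1.2) ∨ l.2 = (l.1.1, l.1.2 - 1))

instance : DecidablePred IsLozenge := fun _ => by unfold IsLozenge; infer_instance

/-- The lozenges contained in the region `R` (a finite set of unit triangles). -/
def lozengesIn (R : Finset UnitTriangle) : Finset (UnitTriangle × UnitTriangle) :=
  (R ×ˢ R).filter IsLozenge

/-- The lozenge tilings of `R`: the sets of lozenges contained in `R` such that every unit triangle
of `R` belongs to exactly one of them. -/
def tilings (R : Finset UnitTriangle) : Finset (Finset (UnitTriangle × UnitTriangle)) :=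
  (lozengesIn R).powerset.filter fun T =>
    ∀ t ∈ R, (T.filter fun l => t = l.1 ∨ t = l.2).card = 1

/-- The symmetric weight: a vertical lozenge with center `(i, j)` has weight `(q^i + q^(-i)) / 2`,
every other lozenge has weight `1`. -/
def symmetricWeight {K : Type*} [Field K] (q : K) (l : UnitTriangle × UnitTriangle) : K :=
  if l.2 = (l.1.1, l.1.2 - 1) then (q ^ l.1.1 + q ^ (-l.1.1)) / 2 else 1

/-- The tiling generating function of `R` for the symmetric weight. -/
def tilingGF {K : Type*} [Field K] (q : K) (R : Finset UnitTriangle) : K :=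
  ∑ T ∈ tilings R, ∏ l ∈ T, symmetricWeight q l

/-- The right trapezoid with north side `x`, base `x + n` on the horizontal axis, and `2 n - 1` rows
of unit triangles. The west side is the vertical zigzag through the points
`(0, 0), (1, 1), (0, 2), (1, 3), …, (1, 2 n - 1)`, so that the vertical axis touches it from the
west; the northeast side is the lattice line from `(2 (x + n), 0)` to `(2 x + 1, 2 n - 1)`. -/
noncomputable def trapezoid (x n : ℕ) : Finset UnitTriangle :=
  (Finset.Icc (1 : ℤ) (2 * (x + n) - 1) ×ˢ Finset.Ico (0 : ℤ) (2 * n - 1)).filter fun t =>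
    t.1 + t.2 ≤ 2 * (x + n) - 1

/-- The `s`-th up-pointing unit triangle, `s = 1, 2, …`, along the base, counted from the left: its
base is the segment from `(2 (s - 1), 0)` to `(2 s, 0)`. -/
def baseTriangle (s : ℕ) : UnitTriangle := (2 * (s : ℤ) - 1, 0)

/-- The quartered hexagon: the trapezoid with dents at the positions `s 0, …, s (n - 1)`. -/
noncomputable def quarteredHexagon (x : ℕ) {n : ℕ} (s : Fin n → ℕ) : Finset UnitTriangle :=
  trapezoid x n \ Finset.univ.image fun i => baseTriangle (s i)

/-- The `q`-integer `[m]_q = 1 + q + ⋯ + q^(m-1)`. -/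
def qInt {K : Type*} [Field K] (q : K) (m : ℕ) : K := ∑ k ∈ Finset.range m, q ^ k

/-- The `q`-factorial `[m]_q! = [1]_q [2]_q ⋯ [m]_q`. -/
def qFactorial {K : Type*} [Field K] (q : K) (m : ℕ) : K :=
  ∏ k ∈ Finset.range m, qInt q (k + 1)

/-! Cut the region along the horizontal lattice lines and build it up row by row. Within one row,
consecutive unit triangles are neighbours, so the row is a path. After deleting the dents and the
lower halves of the vertical lozenges sticking out at the top, it has a tiling exactly when every
remaining run has even length, and then only one. This forces the abscissae of the vertical lozenges
to interlace strictly with the dents (`sum_tilingGF_row`), and they become the dents of the next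
row. On even rows `m + 1` dents yield `m`; on odd rows `m` dents yield `m`, since the west zigzag
acts as an extra dent at abscissa `0`.

The generating function is thus an iterated sum over interlacing sequences with weight `w t = (q ^ t
+ q ^ (-t)) / 2` per entry. Such a sum preserves determinants `det (g k (r i))`: by multilinearity
each row is summed over its own gap, and it telescopes if `w * g k` has a discrete antiderivative.
Here the central factorials `oddProd` and `evenProd` in the symmetric q-numbers `[t]` are
antiderivatives of one another, up to constants `2 [2k+1]` and `2 [2k+2]` (`evenProd_sub`,
`oddProd_succ_sub`). This rests on `[t+a] - [t-a] = [a] (q^t + q^(-t))`.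

Induction over pairs of rows gives a constant times `det (oddProd k (a i))`
(`tilingGF_dentedTrapezoid_eq_det`). As `oddProd k` is monic of degree `k` in `[t]^2`, this is a
Vandermonde determinant, and `[a]^2 - [b]^2 = [a+b] [a-b]` factors it. The accumulated constants are
the denominators. -/

theorem mem_lozengesIn {R : Finset UnitTriangle} {l : UnitTriangle × UnitTriangle} :
    l ∈ lozengesIn R ↔ l.1 ∈ R ∧ l.2 ∈ R ∧ IsLozenge l := by
  simp [lozengesIn, and_assoc]

theorem mem_tilings {R : Finset UnitTriangle} {T : Finset (UnitTriangle × UnitTriangle)} :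
    T ∈ tilings R ↔ (∀ l ∈ T, l.1 ∈ R ∧ l.2 ∈ R ∧ IsLozenge l) ∧
      (∀ t ∈ R, ∃ l ∈ T, t = l.1 ∨ t = l.2) ∧
      ∀ t ∈ R, ∀ l ∈ T, ∀ l' ∈ T, (t = l.1 ∨ t = l.2) → (t = l'.1 ∨ t = l'.2) → l = l' := by
  simp only [tilings, Finset.mem_filter, Finset.mem_powerset, Finset.subset_iff, mem_lozengesIn,
    Finset.card_eq_one, Finset.eq_singleton_iff_unique_mem]
  refine and_congr_right fun _ => ⟨fun h => ⟨fun t ht => ?_, fun t ht l hl l' hl' h1 h2 => ?_⟩,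
    fun h t ht => ?_⟩
  · obtain ⟨l, hl, -⟩ := h t ht
    exact ⟨l, hl⟩
  · obtain ⟨m, -, hm⟩ := h t ht
    rw [hm l ⟨hl, h1⟩, hm l' ⟨hl', h2⟩]
  · obtain ⟨l, hl, hl'⟩ := h.1 t ht
    exact ⟨l, ⟨hl, hl'⟩, fun m hm => h.2 t ht m hm.1 l hl hm.2 hl'⟩

/-- The vertical lozenge whose center is `(b, j + 1)`. -/
def verticalLozenge (j b : ℤ) : UnitTriangle × UnitTriangle := ((b, j + 1), (b, j))

theorem verticalLozenge_injective (j : ℤ) : Function.Injective (verticalLozenge j) := by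
  intro a b h
  simpa [verticalLozenge] using h

theorem symmetricWeight_verticalLozenge {K : Type*} [Field K] (q : K) (j b : ℤ) :
    symmetricWeight q (verticalLozenge j b) = (q ^ b + q ^ (-b)) / 2 := by
  simp [symmetricWeight, verticalLozenge]

/-! ### Splitting off the bottom row of a region -/

section Peel

variable {R₀ R₁ : Finset UnitTriangle} {j : ℤ} {P B : Finset ℤ}
  {T T₀ T₁ : Finset (UnitTriangle × UnitTriangle)}

/-- The partner of an up-pointing triangle is in the same row or just below it, so the only lozenges
crossing the line above row `j` are the vertical ones. -/
theorem lozenge_trichotomy (h₀ : ∀ t ∈ R₀, t.2 = j) (h₁ : ∀ t ∈ R₁, j < t.2)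
    (hP : ∀ b, b ∈ P ↔ (b, j) ∈ R₀ ∧ (b, j + 1) ∈ R₁ ∧ Even (b + j))
    {l : UnitTriangle × UnitTriangle} (hl₁ : l.1 ∈ R₀ ∪ R₁) (hl₂ : l.2 ∈ R₀ ∪ R₁)
    (hl : IsLozenge l) :
    (l.1.2 = j ∧ l.1 ∈ R₀ ∧ l.2 ∈ R₀) ∨ (j < l.2.2 ∧ l.1 ∈ R₁ ∧ l.2 ∈ R₁) ∨
      ∃ b ∈ P, l = verticalLozenge j b := by
  obtain ⟨⟨a, c⟩, ⟨a', c'⟩⟩ := l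
  simp only [Finset.mem_union, IsLozenge, UnitTriangle.IsUp, Prod.mk.injEq] at *
  rcases hl₁ with u | u <;> rcases hl₂ with v | v
  · exact Or.inl ⟨h₀ _ u, u, v⟩
  · have h3 : c = j := h₀ _ u
    have h4 : j < c' := h₁ _ v
    omega
  · have h3 : j < c := h₁ _ u
    have h4 : c' = j := h₀ _ v
    refine Or.inr (Or.inr ⟨a, ?_, ?_⟩)
    · rw [hP]
      have h5 : c = j + 1 := by omega
      have h6 : a' = a := by omega
      subst h5 h6 h4
      refine ⟨v, u, ?_⟩
      grind
    · simp only [verticalLozenge, Prod.mk.injEq]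
      exact ⟨⟨trivial, by omega⟩, by omega, by omega⟩
  · exact Or.inr (Or.inl ⟨h₁ _ v, u, v⟩)

/-- The two halves of the crossing lozenges are exactly the triangles deleted from `R₀` and `R₁`, so
nothing is covered twice or left out. -/
theorem union_mem_tilings (h₀ : ∀ t ∈ R₀, t.2 = j) (h₁ : ∀ t ∈ R₁, j < t.2)
    (hP : ∀ b, b ∈ P ↔ (b, j) ∈ R₀ ∧ (b, j + 1) ∈ R₁ ∧ Even (b + j)) (hB : B ⊆ P)
    (hT₀ : T₀ ∈ tilings (R₀ \ B.image fun b => (b, j)))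
    (hT₁ : T₁ ∈ tilings (R₁ \ B.image fun b => (b, j + 1))) :
    T₀ ∪ T₁ ∪ B.image (verticalLozenge j) ∈ tilings (R₀ ∪ R₁) := by
  rw [mem_tilings] at *
  obtain ⟨a1, a2, a3⟩ := hT₀
  obtain ⟨b1, b2, b3⟩ := hT₁
  have hd : ∀ t ∈ R₀, t ∉ R₁ := fun t ht ht' => by
    have := h₀ t ht; have := h₁ t ht'; omega
  simp only [Finset.mem_union, Finset.mem_sdiff, Finset.mem_image] at *
  have hv : ∀ b ∈ B, IsLozenge (verticalLozenge j b) := by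
    intro b hb
    have := ((hP b).1 (hB hb)).2.2
    simp only [IsLozenge, verticalLozenge, UnitTriangle.IsUp]
    constructor
    · grind
    · simp
  refine ⟨?_, ?_, ?_⟩
  · rintro l ((hl | hl) | ⟨b, hb, rfl⟩)
    · exact ⟨Or.inl (a1 l hl).1.1, Or.inl (a1 l hl).2.1.1, (a1 l hl).2.2⟩
    · exact ⟨Or.inr (b1 l hl).1.1, Or.inr (b1 l hl).2.1.1, (b1 l hl).2.2⟩
    · exact ⟨Or.inr ((hP b).1 (hB hb)).2.1, Or.inl ((hP b).1 (hB hb)).1, hv b hb⟩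
  · rintro t (ht | ht)
    · by_cases h : ∃ b ∈ B, (b, j) = t
      · obtain ⟨b, hb, rfl⟩ := h
        exact ⟨_, Or.inr ⟨b, hb, rfl⟩, Or.inr rfl⟩
      · obtain ⟨l, hl, h'⟩ := a2 t ⟨ht, h⟩
        exact ⟨l, Or.inl (Or.inl hl), h'⟩
    · by_cases h : ∃ b ∈ B, (b, j + 1) = t
      · obtain ⟨b, hb, rfl⟩ := h
        exact ⟨_, Or.inr ⟨b, hb, rfl⟩, Or.inl rfl⟩
      · obtain ⟨l, hl, h'⟩ := b2 t ⟨ht, h⟩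
        exact ⟨l, Or.inl (Or.inr hl), h'⟩
  · have k0 : ∀ l ∈ T₀, ∀ t, (t = l.1 ∨ t = l.2) → t ∈ R₀ ∧ ¬ ∃ b ∈ B, (b, j) = t := by
      rintro l hl t (rfl | rfl)
      exacts [(a1 l hl).1, (a1 l hl).2.1]
    have k1 : ∀ l ∈ T₁, ∀ t, (t = l.1 ∨ t = l.2) → t ∈ R₁ ∧ ¬ ∃ b ∈ B, (b, j + 1) = t := by
      rintro l hl t (rfl | rfl)
      exacts [(b1 l hl).1, (b1 l hl).2.1]
    have k2 : ∀ b ∈ B, ∀ t, (t = (verticalLozenge j b).1 ∨ t = (verticalLozenge j b).2) →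
        (t ∈ R₀ ∧ t = (b, j)) ∨ (t ∈ R₁ ∧ t = (b, j + 1)) := by
      rintro b hb t (rfl | rfl)
      · exact Or.inr ⟨((hP b).1 (hB hb)).2.1, rfl⟩
      · exact Or.inl ⟨((hP b).1 (hB hb)).1, rfl⟩
    rintro t - l ((hl | hl) | ⟨b, hb, rfl⟩) l' ((hl' | hl') | ⟨b', hb', rfl⟩) h h'
    · exact a3 t (k0 l hl t h) l hl l' hl' h h'
    · exact absurd (k1 l' hl' t h').1 (hd t (k0 l hl t h).1)
    · have := k0 l hl t h
      rcases k2 b' hb' t h' with u | u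
      · exact absurd ⟨b', hb', u.2.symm⟩ this.2
      · exact absurd u.1 (hd t this.1)
    · exact absurd (k1 l hl t h).1 (hd t (k0 l' hl' t h').1)
    · exact b3 t (k1 l hl t h) l hl l' hl' h h'
    · have := k1 l hl t h
      rcases k2 b' hb' t h' with u | u
      · exact absurd this.1 (hd t u.1)
      · exact absurd ⟨b', hb', u.2.symm⟩ this.2
    · have := k0 l' hl' t h'
      rcases k2 b hb t h with u | u
      · exact absurd ⟨b, hb, u.2.symm⟩ this.2
      · exact absurd u.1 (hd t this.1)
    · have := k1 l' hl' t h'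
      rcases k2 b hb t h with u | u
      · exact absurd this.1 (hd t u.1)
      · exact absurd ⟨b, hb, u.2.symm⟩ this.2
    · rcases k2 b hb t h with u | u <;> rcases k2 b' hb' t h' with v | v
      · have := u.2.symm.trans v.2
        rw [show b = b' by simpa using this]
      · exact absurd v.1 (hd t u.1)
      · exact absurd u.1 (hd t v.1)
      · have := u.2.symm.trans v.2
        rw [show b = b' by simpa using this]

theorem filter_bottom_mem_tilings (h₀ : ∀ t ∈ R₀, t.2 = j) (h₁ : ∀ t ∈ R₁, j < t.2)
    (hP : ∀ b, b ∈ P ↔ (b, j) ∈ R₀ ∧ (b, j + 1) ∈ R₁ ∧ Even (b + j))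
    (hT : T ∈ tilings (R₀ ∪ R₁)) :
    T.filter (fun l => l.1.2 = j) ∈
      tilings (R₀ \ (P.filter fun b => verticalLozenge j b ∈ T).image fun b => (b, j)) := by
  rw [mem_tilings] at *
  obtain ⟨a1, a2, a3⟩ := hT
  have tri := fun l hl => lozenge_trichotomy h₀ h₁ hP (a1 l hl).1 (a1 l hl).2.1 (a1 l hl).2.2
  simp only [Finset.mem_sdiff, Finset.mem_image, Finset.mem_filter] at *
  refine ⟨?_, ?_, ?_⟩
  · rintro l ⟨hl, hj⟩
    have hR : l.1 ∈ R₀ ∧ l.2 ∈ R₀ := by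
      rcases tri l hl with h | h | ⟨b, hb, rfl⟩
      · exact h.2
      · have := h₁ _ h.2.1; omega
      · simp [verticalLozenge] at hj
    have key : ∀ b, verticalLozenge j b ∈ T → ∀ t ∈ R₀, (t = l.1 ∨ t = l.2) → (b, j) ≠ t := by
      rintro b hb t ht h rfl
      have := a3 _ (Finset.mem_union_left _ ht) l hl _ hb h (Or.inr rfl)
      subst this
      simp [verticalLozenge] at hj
    refine ⟨⟨hR.1, ?_⟩, ⟨hR.2, ?_⟩, (a1 l hl).2.2⟩
    · rintro ⟨b, hb, h⟩
      exact key b hb.2 _ hR.1 (Or.inl rfl) h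
    · rintro ⟨b, hb, h⟩
      exact key b hb.2 _ hR.2 (Or.inr rfl) h
  · rintro t ⟨ht, hn⟩
    obtain ⟨l, hl, h⟩ := a2 t (Finset.mem_union_left _ ht)
    refine ⟨l, ⟨hl, ?_⟩, h⟩
    have htj := h₀ t ht
    rcases tri l hl with h' | h' | ⟨b, hb, rfl⟩
    · exact h'.1
    · have e1 := h₁ _ h'.2.1
      have e2 := h₁ _ h'.2.2
      rcases h with rfl | rfl <;> omega
    · exfalso
      rcases h with rfl | rfl
      · simp [verticalLozenge] at htj
      · exact hn ⟨b, ⟨hb, hl⟩, rfl⟩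
  · rintro t ⟨ht, -⟩ l hl l' hl'
    exact a3 t (Finset.mem_union_left _ ht) l hl.1 l' hl'.1

theorem filter_top_mem_tilings (h₀ : ∀ t ∈ R₀, t.2 = j) (h₁ : ∀ t ∈ R₁, j < t.2)
    (hP : ∀ b, b ∈ P ↔ (b, j) ∈ R₀ ∧ (b, j + 1) ∈ R₁ ∧ Even (b + j))
    (hT : T ∈ tilings (R₀ ∪ R₁)) :
    T.filter (fun l => j < l.2.2) ∈
      tilings (R₁ \ (P.filter fun b => verticalLozenge j b ∈ T).image fun b => (b, j + 1)) := by
  rw [mem_tilings] at *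
  obtain ⟨a1, a2, a3⟩ := hT
  have tri := fun l hl => lozenge_trichotomy h₀ h₁ hP (a1 l hl).1 (a1 l hl).2.1 (a1 l hl).2.2
  simp only [Finset.mem_sdiff, Finset.mem_image, Finset.mem_filter] at *
  refine ⟨?_, ?_, ?_⟩
  · rintro l ⟨hl, hj⟩
    have hR : l.1 ∈ R₁ ∧ l.2 ∈ R₁ := by
      rcases tri l hl with h | h | ⟨b, hb, rfl⟩
      · have := h₀ _ h.2.2; omega
      · exact h.2
      · simp [verticalLozenge] at hj
    have key : ∀ b, verticalLozenge j b ∈ T → ∀ t ∈ R₁, (t = l.1 ∨ t = l.2) → (b, j + 1) ≠ t := by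
      rintro b hb t ht h rfl
      have := a3 _ (Finset.mem_union_right _ ht) l hl _ hb h (Or.inl rfl)
      subst this
      simp [verticalLozenge] at hj
    refine ⟨⟨hR.1, ?_⟩, ⟨hR.2, ?_⟩, (a1 l hl).2.2⟩
    · rintro ⟨b, hb, h⟩
      exact key b hb.2 _ hR.1 (Or.inl rfl) h
    · rintro ⟨b, hb, h⟩
      exact key b hb.2 _ hR.2 (Or.inr rfl) h
  · rintro t ⟨ht, hn⟩
    obtain ⟨l, hl, h⟩ := a2 t (Finset.mem_union_right _ ht)
    refine ⟨l, ⟨hl, ?_⟩, h⟩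
    have htj := h₁ t ht
    rcases tri l hl with h' | h' | ⟨b, hb, rfl⟩
    · have e1 := h₀ _ h'.2.1
      have e2 := h₀ _ h'.2.2
      rcases h with rfl | rfl <;> omega
    · exact h'.1
    · exfalso
      rcases h with rfl | rfl
      · exact hn ⟨b, ⟨hb, hl⟩, rfl⟩
      · simp [verticalLozenge] at htj
  · rintro t ⟨ht, -⟩ l hl l' hl'
    exact a3 t (Finset.mem_union_right _ ht) l hl.1 l' hl'.1

/-- Splitting off the bottom row `R₀` of a region: the sum runs over the set `B` of abscissae of
the vertical lozenges that stick out of the bottom row. -/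
theorem tilingGF_union {K : Type*} [Field K] (q : K) (h₀ : ∀ t ∈ R₀, t.2 = j)
    (h₁ : ∀ t ∈ R₁, j < t.2)
    (hP : ∀ b, b ∈ P ↔ (b, j) ∈ R₀ ∧ (b, j + 1) ∈ R₁ ∧ Even (b + j)) :
    tilingGF q (R₀ ∪ R₁) = ∑ B ∈ P.powerset, (∏ b ∈ B, (q ^ b + q ^ (-b)) / 2) *
      (tilingGF q (R₀ \ B.image fun b => (b, j)) *
        tilingGF q (R₁ \ B.image fun b => (b, j + 1))) := by
  simp only [tilingGF, Finset.sum_mul_sum, ← Finset.sum_product']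
  simp only [Finset.mul_sum]
  rw [Finset.sum_sigma']
  symm
  have hb0 : ∀ B : Finset ℤ, ∀ T₀ ∈ tilings (R₀ \ B.image fun b => (b, j)), ∀ l ∈ T₀,
      l.1.2 = j ∧ l.2.2 = j := fun B T₀ h l hl => by
    have := (mem_tilings.1 h).1 l hl
    simp only [Finset.mem_sdiff] at this
    exact ⟨h₀ _ this.1.1, h₀ _ this.2.1.1⟩
  have hb1 : ∀ B : Finset ℤ, ∀ T₁ ∈ tilings (R₁ \ B.image fun b => (b, j + 1)), ∀ l ∈ T₁,
      j < l.1.2 ∧ j < l.2.2 := fun B T₀ h l hl => by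
    have := (mem_tilings.1 h).1 l hl
    simp only [Finset.mem_sdiff] at this
    exact ⟨h₁ _ this.1.1, h₁ _ this.2.1.1⟩
  -- The inverse recovers `T₀` from the up triangles in row `j` and `T₁` from the down triangles
  -- above row `j`; a crossing lozenge meets neither condition.
  refine Finset.sum_bij'
    (fun p _ => p.2.1 ∪ p.2.2 ∪ p.1.image (verticalLozenge j))
    (fun T _ => ⟨P.filter fun b => verticalLozenge j b ∈ T,
      T.filter fun l => l.1.2 = j, T.filter fun l => j < l.2.2⟩) ?_ ?_ ?_ ?_ ?_
  · rintro ⟨B, T₀, T₁⟩ hp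
    simp only [Finset.mem_sigma, Finset.mem_powerset, Finset.mem_product] at hp ⊢
    exact union_mem_tilings h₀ h₁ hP hp.1 hp.2.1 hp.2.2
  · intro T hT
    simp only [Finset.mem_sigma, Finset.mem_powerset, Finset.mem_product]
    exact ⟨Finset.filter_subset _ _, filter_bottom_mem_tilings h₀ h₁ hP hT,
      filter_top_mem_tilings h₀ h₁ hP hT⟩
  · rintro ⟨B, T₀, T₁⟩ hp
    simp only [Finset.mem_sigma, Finset.mem_powerset, Finset.mem_product] at hp
    have c0 := hb0 B T₀ hp.2.1
    have c1 := hb1 B T₁ hp.2.2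
    have eB : (P.filter fun b => verticalLozenge j b ∈
        T₀ ∪ T₁ ∪ B.image (verticalLozenge j)) = B := by
      ext b
      simp only [Finset.mem_filter, Finset.mem_union, Finset.mem_image,
        (verticalLozenge_injective j).eq_iff, exists_eq_right]
      constructor
      · rintro ⟨-, (h | h) | h⟩
        · have := (c0 _ h).1; simp [verticalLozenge] at this
        · have := (c1 _ h).2; simp [verticalLozenge] at this
        · exact h
      · exact fun h => ⟨hp.1 h, Or.inr h⟩
    have e0 : ((T₀ ∪ T₁ ∪ B.image (verticalLozenge j)).filter fun l => l.1.2 = j) = T₀ := by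
      ext l
      simp only [Finset.mem_filter, Finset.mem_union, Finset.mem_image]
      constructor
      · rintro ⟨(h | h) | ⟨b, -, rfl⟩, h'⟩
        · exact h
        · have := (c1 _ h).1; omega
        · simp [verticalLozenge] at h'
      · exact fun h => ⟨Or.inl (Or.inl h), (c0 l h).1⟩
    have e1 : ((T₀ ∪ T₁ ∪ B.image (verticalLozenge j)).filter fun l => j < l.2.2) = T₁ := by
      ext l
      simp only [Finset.mem_filter, Finset.mem_union, Finset.mem_image]
      constructor
      · rintro ⟨(h | h) | ⟨b, -, rfl⟩, h'⟩
        · have := (c0 _ h).2; omega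
        · exact h
        · simp [verticalLozenge] at h'
      · exact fun h => ⟨Or.inl (Or.inr h), (c1 l h).2⟩
    simp only [eB, e0, e1]
  · intro T hT
    have a1 := (mem_tilings.1 hT).1
    ext l
    simp only [Finset.mem_filter, Finset.mem_union, Finset.mem_image]
    constructor
    · rintro ((h | h) | ⟨b, h, rfl⟩)
      exacts [h.1, h.1, h.2]
    · intro hl
      rcases lozenge_trichotomy h₀ h₁ hP (a1 l hl).1 (a1 l hl).2.1 (a1 l hl).2.2 with
        h | h | ⟨b, hb, rfl⟩
      · exact Or.inl (Or.inl ⟨hl, h.1⟩)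
      · exact Or.inl (Or.inr ⟨hl, h.1⟩)
      · exact Or.inr ⟨b, ⟨hb, hl⟩, rfl⟩
  · rintro ⟨B, T₀, T₁⟩ hp
    simp only [Finset.mem_sigma, Finset.mem_powerset, Finset.mem_product] at hp
    have c0 := hb0 B T₀ hp.2.1
    have c1 := hb1 B T₁ hp.2.2
    have d1 : Disjoint T₀ T₁ := Finset.disjoint_left.2 fun l hl hl' => by
      have := (c0 l hl).1; have := (c1 l hl').1; omega
    have d2 : Disjoint (T₀ ∪ T₁) (B.image (verticalLozenge j)) := by
      rw [Finset.disjoint_left]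
      rintro l hl hl'
      obtain ⟨b, -, rfl⟩ := Finset.mem_image.1 hl'
      rcases Finset.mem_union.1 hl with h | h
      · have := (c0 _ h).1; simp [verticalLozenge] at this
      · have := (c1 _ h).2; simp [verticalLozenge] at this
    rw [Finset.prod_union d2, Finset.prod_union d1,
      Finset.prod_image (fun a _ b _ h => verticalLozenge_injective j h)]
    simp only [symmetricWeight_verticalLozenge]
    ring

end Peel

/-! ### Forced lozenges and tilings of a single row -/

/-- Every tiling must cover `t`, hence contains `l`; erasing `l` is a bijection onto the tilings of
the rest. -/
theorem tilingGF_of_forced {K : Type*} [Field K] (q : K) {R : Finset UnitTriangle}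
    {l : UnitTriangle × UnitTriangle} (hl : l ∈ lozengesIn R) {t : UnitTriangle}
    (ht : t = l.1 ∨ t = l.2) (h : ∀ l' ∈ lozengesIn R, (t = l'.1 ∨ t = l'.2) → l' = l) :
    tilingGF q R = symmetricWeight q l * tilingGF q (R \ {l.1, l.2}) := by
  rw [mem_lozengesIn] at hl
  have htR : t ∈ R := by rcases ht with rfl | rfl; exacts [hl.1, hl.2.1]
  have hmem : ∀ T ∈ tilings R, l ∈ T := fun T hT => by
    rw [mem_tilings] at hT
    obtain ⟨l', hl', h'⟩ := hT.2.1 t htR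
    rwa [← h l' (mem_lozengesIn.2 (hT.1 l' hl')) h']
  have hnot : ∀ T ∈ tilings (R \ {l.1, l.2}), l ∉ T := fun T hT hlT => by
    have := ((mem_tilings.1 hT).1 l hlT).1
    simp at this
  rw [tilingGF, tilingGF, Finset.mul_sum]
  refine Finset.sum_bij' (fun T _ => T.erase l) (fun T _ => insert l T) ?_ ?_ ?_ ?_ ?_
  · intro T hT
    have hlT := hmem T hT
    rw [mem_tilings] at hT ⊢
    obtain ⟨a1, a2, a3⟩ := hT
    simp only [Finset.mem_erase, Finset.mem_sdiff, Finset.mem_insert, Finset.mem_singleton]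
    refine ⟨fun m hm => ⟨⟨(a1 m hm.2).1, fun h' => hm.1 ?_⟩,
      ⟨(a1 m hm.2).2.1, fun h' => hm.1 ?_⟩, (a1 m hm.2).2.2⟩, fun s hs => ?_, fun s hs m hm m' hm' =>
        a3 s hs.1 m hm.2 m' hm'.2⟩
    · exact a3 _ (a1 m hm.2).1 m hm.2 l hlT (Or.inl rfl) h'
    · exact a3 _ (a1 m hm.2).2.1 m hm.2 l hlT (Or.inr rfl) h'
    · obtain ⟨m, hm, hs'⟩ := a2 s hs.1
      refine ⟨m, ⟨?_, hm⟩, hs'⟩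
      rintro rfl
      exact hs.2 hs'
  · intro T hT
    have hlT := hnot T hT
    rw [mem_tilings] at hT ⊢
    obtain ⟨a1, a2, a3⟩ := hT
    simp only [Finset.mem_sdiff, Finset.mem_insert, Finset.mem_singleton] at *
    have key : ∀ m ∈ T, ∀ s, (s = m.1 ∨ s = m.2) → ¬ (s = l.1 ∨ s = l.2) := by
      rintro m hm s (rfl | rfl)
      exacts [(a1 m hm).1.2, (a1 m hm).2.1.2]
    refine ⟨?_, fun s hs => ?_, ?_⟩
    · rintro m (rfl | hm)
      · exact hl
      · exact ⟨(a1 m hm).1.1, (a1 m hm).2.1.1, (a1 m hm).2.2⟩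
    · by_cases h' : s = l.1 ∨ s = l.2
      · exact ⟨l, Or.inl rfl, h'⟩
      · obtain ⟨m, hm, hs'⟩ := a2 s ⟨hs, h'⟩
        exact ⟨m, Or.inr hm, hs'⟩
    · rintro s hs m (rfl | hm) m' (rfl | hm') h1 h2
      · rfl
      · exact absurd h1 (key m' hm' s h2)
      · exact absurd h2 (key m hm s h1)
      · exact a3 s ⟨hs, key m hm s h1⟩ m hm m' hm' h1 h2
  · intro T hT
    exact Finset.insert_erase (hmem T hT)
  · intro T hT
    exact Finset.erase_insert (hnot T hT)
  · intro T hT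
    exact (Finset.mul_prod_erase T _ (hmem T hT)).symm

theorem tilingGF_eq_zero {K : Type*} [Field K] (q : K) {R : Finset UnitTriangle}
    {t : UnitTriangle} (ht : t ∈ R) (h : ∀ l ∈ lozengesIn R, ¬ (t = l.1 ∨ t = l.2)) :
    tilingGF q R = 0 := by
  rw [tilingGF, Finset.sum_eq_zero]
  intro T hT
  rw [mem_tilings] at hT
  obtain ⟨l, hl, h'⟩ := hT.2.1 t ht
  exact absurd h' (h l (mem_lozengesIn.2 (hT.1 l hl)))

theorem tilingGF_empty {K : Type*} [Field K] (q : K) : tilingGF q ∅ = 1 := by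
  have : tilings ∅ = {∅} := by
    ext T
    rw [mem_tilings, Finset.mem_singleton]
    constructor
    · intro h
      exact Finset.eq_empty_of_forall_notMem fun l hl => by simpa using (h.1 l hl).1
    · rintro rfl; simp
  simp [tilingGF, this]

/-- Consecutive elements of the complement of `S` in the interval `[a, b]` have opposite parity. -/
def OddGaps (a b : ℤ) (S : Finset ℤ) : Prop :=
  ∀ t t', a ≤ t → t' ≤ b → t ∉ S → t' ∉ S → t < t' → (∀ u, t < u → u < t' → u ∈ S) → Odd (t' - t)

/-- The unit triangles in row `j` with abscissae in `S`. -/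
def rowTriangles (j : ℤ) (S : Finset ℤ) : Finset UnitTriangle := S.image fun i => (i, j)

theorem mem_rowTriangles {j : ℤ} {S : Finset ℤ} {t : UnitTriangle} :
    t ∈ rowTriangles j S ↔ t.1 ∈ S ∧ t.2 = j := by
  obtain ⟨a, b⟩ := t
  simp only [rowTriangles, Finset.mem_image, Prod.mk.injEq]
  constructor
  · rintro ⟨i, h, rfl, rfl⟩; exact ⟨h, rfl⟩
  · rintro ⟨h, rfl⟩; exact ⟨a, h, rfl, rfl⟩

/-- The right end `k` of a run can only be paired with `k - 1`; the parity of `k + j` merely decides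
which of the two is the up triangle. -/
theorem tilingGF_row_last {K : Type*} [Field K] (q : K) (j k : ℤ) {S : Finset ℤ} (hk : k ∈ S)
    (hk' : k - 1 ∈ S) (hS : k + 1 ∉ S) :
    tilingGF q (rowTriangles j S) = tilingGF q (rowTriangles j (S \ {k - 1, k})) := by
  have key : ∀ l ∈ lozengesIn (rowTriangles j S), ((k, j) = l.1 ∨ (k, j) = l.2) →
      l = if Odd (k + j) then ((k, j), (k - 1, j)) else ((k - 1, j), (k, j)) := by
    rintro ⟨⟨a, b⟩, ⟨c, d⟩⟩ hl h
    simp only [mem_lozengesIn, mem_rowTriangles, IsLozenge, UnitTriangle.IsUp, Prod.mk.injEq] at hl h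
    obtain ⟨⟨h1, rfl⟩, ⟨h2, rfl⟩, h3, h4⟩ := hl
    rcases h with ⟨rfl, -⟩ | ⟨rfl, -⟩
    · rw [if_pos h3]
      simp only [Prod.mk.injEq, and_true, true_and]
      rcases h4 with h4 | h4 | h4
      · exact h4.1
      · rw [← h4.1] at hS; exact absurd h2 hS
      · omega
    · rcases h4 with h4 | h4 | h4
      · exact absurd (show k + 1 ∈ S by rwa [h4.1, sub_add_cancel]) hS
      · rw [if_neg (by grind)]
        simp only [Prod.mk.injEq, and_true]
        omega
      · omega
  by_cases hodd : Odd (k + j)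
  · simp only [if_pos hodd] at key
    rw [tilingGF_of_forced q (l := ((k, j), (k - 1, j))) (t := (k, j)) ?_ (Or.inl rfl) key]
    · have e : rowTriangles j S \ {(k, j), (k - 1, j)} = rowTriangles j (S \ {k - 1, k}) := by
        ext ⟨a, b⟩
        simp only [Finset.mem_sdiff, mem_rowTriangles, Finset.mem_insert, Finset.mem_singleton,
          Prod.mk.injEq]
        grind
      simp [symmetricWeight, e]
    · simp [mem_lozengesIn, mem_rowTriangles, IsLozenge, UnitTriangle.IsUp, hk, hk', hodd]
  · simp only [if_neg hodd] at key
    rw [tilingGF_of_forced q (l := ((k - 1, j), (k, j))) (t := (k, j)) ?_ (Or.inr rfl) key]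
    · have e : rowTriangles j S \ {(k - 1, j), (k, j)} = rowTriangles j (S \ {k - 1, k}) := by
        ext ⟨a, b⟩
        simp only [Finset.mem_sdiff, mem_rowTriangles, Finset.mem_insert, Finset.mem_singleton,
          Prod.mk.injEq]
        grind
      simp only [symmetricWeight, e, Prod.mk.injEq]
      rw [if_neg (by omega), one_mul]
    · have : Odd (k - 1 + j) := by grind
      simp [mem_lozengesIn, mem_rowTriangles, IsLozenge, UnitTriangle.IsUp, hk, hk', this]

theorem tilingGF_row_isolated {K : Type*} [Field K] (q : K) (j k : ℤ) {S : Finset ℤ} (hk : k ∈ S)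
    (hk' : k - 1 ∉ S) (hS : k + 1 ∉ S) : tilingGF q (rowTriangles j S) = 0 := by
  refine tilingGF_eq_zero q (t := (k, j)) (mem_rowTriangles.2 ⟨hk, rfl⟩) ?_
  rintro ⟨⟨a, b⟩, ⟨c, d⟩⟩ hl h
  simp only [mem_lozengesIn, mem_rowTriangles, IsLozenge, UnitTriangle.IsUp, Prod.mk.injEq] at hl h
  obtain ⟨⟨h1, rfl⟩, ⟨h2, rfl⟩, h3, h4⟩ := hl
  rcases h with ⟨rfl, -⟩ | ⟨rfl, -⟩
  · rcases h4 with h4 | h4 | h4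
    · rw [h4.1] at h2; exact hk' h2
    · rw [h4.1] at h2; exact hS h2
    · omega
  · rcases h4 with h4 | h4 | h4
    · exact hS (by rwa [h4.1, sub_add_cancel])
    · exact hk' (by rwa [h4.1, add_sub_cancel_right])
    · omega

-- A row is a path, so it is tiled in at most one way, and is tileable iff all its runs are even.
-- The positions `a` and `a + 1 + n` lie outside `S` and act as sentinels, so that `OddGaps` also
-- controls the first and last run. The induction works from the right end.
open Classical in
theorem tilingGF_row {K : Type*} [Field K] (q : K) (j a : ℤ) (n : ℕ) (S : Finset ℤ)
    (hS : S ⊆ Finset.Ioo a (a + 1 + n)) :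
    tilingGF q (rowTriangles j S) = if OddGaps a (a + 1 + n) S then 1 else 0 := by
  induction n using Nat.strong_induction_on generalizing S with
  | _ n ih =>
  have hS' : ∀ u ∈ S, a < u ∧ u < a + 1 + n := fun u hu => by simpa using hS hu
  have haS : a ∉ S := fun h => by have := hS' _ h; omega
  have hbS : a + 1 + n ∉ S := fun h => by have := hS' _ h; omega
  rcases Nat.eq_zero_or_pos n with rfl | hn
  · have : S = ∅ := Finset.eq_empty_of_forall_notMem fun u hu => by have := hS' u hu; omega
    subst this
    rw [if_pos]
    · simp [rowTriangles, tilingGF_empty]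
    · intro t t' h1 h2 _ _ h3 _
      have : t' - t = 1 := by omega
      rw [this]; exact odd_one
  by_cases h1 : a + n ∈ S
  · by_cases h2 : a + n - 1 ∈ S
    · have hn2 : 2 ≤ n := by have := hS' _ h2; omega
      obtain ⟨m, rfl⟩ := Nat.exists_eq_add_of_le' hn2
      -- Removing the last pair moves the right sentinel by two, which preserves the parity of the
      -- last gap.
      rw [tilingGF_row_last q j (a + (m + 2 : ℕ)) h1 h2 (by rwa [add_right_comm] at hbS),
        ih m (by omega)]
      · congr 1
        rw [eq_iff_iff]
        constructor
        · intro h t t' u1 u2 u3 u4 u5 u6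
          by_cases ht' : t' ≤ a + 1 + m
          · refine h t t' u1 ht' (by grind) (by grind) u5 fun u v1 v2 => ?_
            have := u6 u v1 v2
            simp only [Finset.mem_sdiff, Finset.mem_insert, Finset.mem_singleton]
            refine ⟨this, ?_⟩
            push_cast; omega
          · have e : t' = a + 1 + (m + 2 : ℕ) := by
              by_contra hne
              have : t' = a + (m + 2 : ℕ) ∨ t' = a + (m + 2 : ℕ) - 1 := by push_cast at *; omega
              rcases this with rfl | rfl
              · exact u4 h1
              · exact u4 h2
            have hlt : t < a + 1 + m := by
              by_contra hlt
              have : t = a + (m + 2 : ℕ) ∨ t = a + (m + 2 : ℕ) - 1 := by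
                push_cast at *; omega
              rcases this with rfl | rfl
              · exact u3 h1
              · exact u3 h2
            have := h t (a + 1 + m) u1 le_rfl (by grind) (by push_cast; grind) hlt
              fun u v1 v2 => by
                have := u6 u v1 (by push_cast at *; omega)
                simp only [Finset.mem_sdiff, Finset.mem_insert, Finset.mem_singleton]
                refine ⟨this, ?_⟩
                push_cast; omega
            subst e
            push_cast
            grind
        · intro h t t' u1 u2 u3 u4 u5 u6
          have ht : t ∉ S := fun hh => u3 (by
            simp only [Finset.mem_sdiff, Finset.mem_insert, Finset.mem_singleton]
            refine ⟨hh, ?_⟩; push_cast; omega)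
          by_cases ht' : t' < a + 1 + m
          · refine h t t' u1 (by push_cast; omega) ht ?_ u5 fun u v1 v2 => ?_
            · intro hh
              apply u4
              simp only [Finset.mem_sdiff, Finset.mem_insert, Finset.mem_singleton]
              refine ⟨hh, ?_⟩; push_cast; omega
            · exact (Finset.mem_sdiff.1 (u6 u v1 v2)).1
          · have e : t' = a + 1 + m := by omega
            have := h t (a + 1 + (m + 2 : ℕ)) u1 le_rfl ht hbS (by push_cast; omega)
              fun u v1 v2 => by
                by_cases hu : u < t'
                · exact (Finset.mem_sdiff.1 (u6 u v1 hu)).1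
                · have : u = a + (m + 2 : ℕ) ∨ u = a + (m + 2 : ℕ) - 1 := by
                    push_cast at *; omega
                  rcases this with rfl | rfl
                  exacts [h1, h2]
            subst e
            push_cast at this
            grind
      · intro u hu
        simp only [Finset.mem_sdiff, Finset.mem_insert, Finset.mem_singleton] at hu
        have := hS' u hu.1
        rw [Finset.mem_Ioo]
        push_cast at *
        omega
    -- The isolated triangle sits in a gap of length two, contradicting `OddGaps`.
    · rw [tilingGF_row_isolated q j (a + n) h1 h2 (by rwa [add_right_comm] at hbS), if_neg]
      intro h
      have := h (a + n - 1) (a + 1 + n) (by omega) le_rfl h2 hbS (by omega) fun u v1 v2 => by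
        have : u = a + n := by omega
        rwa [this]
      grind
  -- The hole at the last position becomes the new sentinel; the gap dropped has length one.
  · obtain ⟨m, rfl⟩ := Nat.exists_eq_add_of_le' hn
    rw [ih m (by omega)]
    · congr 1
      rw [eq_iff_iff]
      constructor
      · intro h t t' u1 u2 u3 u4 u5 u6
        by_cases ht' : t' ≤ a + 1 + m
        · exact h t t' u1 ht' u3 u4 u5 u6
        · have e : t = a + (m + 1 : ℕ) := by
            by_contra hne
            exact h1 (u6 _ (by push_cast at *; omega) (by push_cast at *; omega))
          have : t' - t = 1 := by push_cast at *; omega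
          rw [this]; exact odd_one
      · intro h t t' u1 u2 u3 u4 u5 u6
        exact h t t' u1 (by push_cast at *; omega) u3 u4 u5 u6
    · intro u hu
      have := hS' u hu
      have : u ≠ a + (m + 1 : ℕ) := fun e => h1 (e ▸ hu)
      rw [Finset.mem_Ioo]
      push_cast at *
      omega

/-! ### Tileable rows and interlacing sequences -/

/-- The sequences that interlace with `a`, of the parity opposite to that of `lo`. -/
noncomputable def interlacing (lo : ℤ) {m : ℕ} (a : Fin (m + 1) → ℤ) : Finset (Fin m → ℤ) :=
  Fintype.piFinset fun i => (Finset.Ioo (a i.castSucc) (a i.succ)).filter fun b => Odd (b - lo)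

theorem mem_interlacing {lo : ℤ} {m : ℕ} {a : Fin (m + 1) → ℤ} {r : Fin m → ℤ} :
    r ∈ interlacing lo a ↔
      ∀ i, (a i.castSucc < r i ∧ r i < a i.succ) ∧ Odd (r i - lo) := by
  simp [interlacing, Fintype.mem_piFinset]

theorem strictMono_of_mem_interlacing {lo : ℤ} {m : ℕ} {a : Fin (m + 1) → ℤ}
    (ha : StrictMono a) {r : Fin m → ℤ} (hr : r ∈ interlacing lo a) : StrictMono r := by
  rw [mem_interlacing] at hr
  intro i k h
  have h1 : a i.succ ≤ a k.castSucc := ha.monotone (by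
    rw [Fin.le_def]; simpa using h)
  exact ((hr i).1.2.trans_le h1).trans (hr k).1.1

/-- Relative to `lo`, the dents are even holes, while the entries of `r` and both sentinels are odd
holes. Interlacing puts a hole of the other kind between any two of the same kind, so consecutive
holes have opposite parity. -/
theorem oddGaps_of_mem_interlacing {lo hi : ℤ} {m : ℕ} {a : Fin (m + 1) → ℤ} (ha : StrictMono a)
    (hpar : ∀ i, Even (a i - lo)) (hhi : Even (hi - lo)) (hrange : ∀ i, lo ≤ a i ∧ a i ≤ hi)
    {r : Fin m → ℤ} (hr : r ∈ interlacing lo a) :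
    OddGaps (lo - 1) (hi + 1)
      ((Finset.Icc lo hi \ Finset.univ.image a) \ Finset.univ.image r) := by
  have hmono := strictMono_of_mem_interlacing ha hr
  rw [mem_interlacing] at hr
  set S := (Finset.Icc lo hi \ Finset.univ.image a) \ Finset.univ.image r with hS
  have haS : ∀ i, a i ∉ S := fun i => by simp [hS]
  have hrS : ∀ i, r i ∉ S := fun i => by simp [hS]
  have hout : ∀ t, lo - 1 ≤ t → t ≤ hi + 1 → t ∉ S →
      (Even (t - lo) ∧ ∃ i, t = a i) ∨ (Odd (t - lo) ∧ (t = lo - 1 ∨ t = hi + 1 ∨ ∃ i, t = r i)) := by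
    intro t h1 h2 h3
    by_cases hr' : ∃ i, t = r i
    · obtain ⟨i, rfl⟩ := hr'
      exact Or.inr ⟨(hr i).2, Or.inr (Or.inr ⟨i, rfl⟩)⟩
    by_cases ha' : ∃ i, t = a i
    · obtain ⟨i, rfl⟩ := ha'
      exact Or.inl ⟨hpar i, i, rfl⟩
    have : ¬ (lo ≤ t ∧ t ≤ hi) := fun h => h3 (by
      simp only [hS, Finset.mem_sdiff, Finset.mem_Icc, Finset.mem_image, Finset.mem_univ, true_and]
      exact ⟨⟨h, fun ⟨i, hi⟩ => ha' ⟨i, hi.symm⟩⟩, fun ⟨i, hi⟩ => hr' ⟨i, hi.symm⟩⟩)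
    have : t = lo - 1 ∨ t = hi + 1 := by omega
    rcases this with rfl | rfl
    · exact Or.inr ⟨by grind, Or.inl rfl⟩
    · exact Or.inr ⟨by grind, Or.inr (Or.inl rfl)⟩
  intro t t' h1 h2 h3 h4 h5 h6
  by_contra hodd
  have hlohi : lo ≤ hi := (hrange 0).1.trans (hrange 0).2
  rcases hout t h1 (by omega) h3 with ⟨e, i, rfl⟩ | ⟨e, h⟩
  · rcases hout t' (by omega) h2 h4 with ⟨e', k, rfl⟩ | ⟨e', -⟩
    · have hik : i < k := ha.lt_iff_lt.1 h5
      have him : (i : ℕ) < m := by have := k.isLt; have := Fin.lt_def.1 hik; omega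
      have hc := hr ⟨i, him⟩
      refine hrS ⟨i, him⟩ (h6 _ hc.1.1 (hc.1.2.trans_le (ha.monotone ?_)))
      rw [Fin.le_def]
      simpa using hik
    · grind
  · rcases hout t' (by omega) h2 h4 with ⟨e', -⟩ | ⟨e', h'⟩
    · grind
    · rcases h with rfl | rfl | ⟨i, rfl⟩
      · refine haS 0 (h6 _ (by have := (hrange 0).1; omega) ?_)
        rcases h' with rfl | rfl | ⟨k, rfl⟩
        · omega
        · have := (hrange 0).2; omega
        · exact (ha.monotone (Fin.zero_le _)).trans_lt (hr k).1.1
      · omega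
      · refine haS i.succ (h6 _ (hr i).1.2 ?_)
        rcases h' with rfl | rfl | ⟨k, rfl⟩
        · omega
        · have := (hrange i.succ).2; omega
        · have hik : i < k := hmono.lt_iff_lt.1 h5
          refine (ha.monotone ?_).trans_lt (hr k).1.1
          rw [Fin.le_def]
          simpa using hik

/-- Two consecutive dents need an element of `B` between them, and two odd holes, sentinels
included, need a dent between them. So each gap between dents contains exactly one element of `B`,
and none lies outside. -/
theorem exists_interlacing_of_oddGaps {lo hi : ℤ} {m : ℕ} {a : Fin (m + 1) → ℤ} (ha : StrictMono a)
    (hpar : ∀ i, Even (a i - lo)) (hhi : Even (hi - lo)) (hrange : ∀ i, lo ≤ a i ∧ a i ≤ hi)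
    {B : Finset ℤ} (hB : ∀ b ∈ B, lo ≤ b ∧ b ≤ hi ∧ Odd (b - lo))
    (h : OddGaps (lo - 1) (hi + 1) ((Finset.Icc lo hi \ Finset.univ.image a) \ B)) :
    ∃ r ∈ interlacing lo a, Finset.univ.image r = B := by
  set S := (Finset.Icc lo hi \ Finset.univ.image a) \ B with hS
  have hmem : ∀ t, t ∈ S ↔ (lo ≤ t ∧ t ≤ hi) ∧ (∀ i, a i ≠ t) ∧ t ∉ B := fun t => by
    simp only [hS, Finset.mem_sdiff, Finset.mem_Icc, Finset.mem_image, Finset.mem_univ, true_and,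
      not_exists, and_assoc, ne_eq]
  have hstep : ∀ i : Fin m, ∀ k, ¬ (a i.castSucc < a k ∧ a k < a i.succ) := by
    rintro i k ⟨h1, h2⟩
    have h1 := Fin.lt_def.1 (ha.lt_iff_lt.1 h1)
    have h2 := Fin.lt_def.1 (ha.lt_iff_lt.1 h2)
    simp at h1 h2
    omega
  have hex : ∀ i : Fin m, ∃ b ∈ B, a i.castSucc < b ∧ b < a i.succ := by
    intro i
    by_contra hno
    push Not at hno
    have hlt : a i.castSucc < a i.succ := ha Fin.castSucc_lt_succ
    have := h (a i.castSucc) (a i.succ) (by have := hrange i.castSucc; omega)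
      (by have := hrange i.succ; omega) (fun hh => ((hmem _).1 hh).2.1 _ rfl)
      (fun hh => ((hmem _).1 hh).2.1 _ rfl) hlt fun u h1 h2 => by
        refine (hmem u).2 ⟨⟨(hrange i.castSucc).1.trans h1.le, h2.le.trans (hrange _).2⟩, ?_, ?_⟩
        · rintro k rfl
          exact hstep i k ⟨h1, h2⟩
        · intro hu
          have := hno u hu h1
          omega
    have e1 := hpar i.castSucc
    have e2 := hpar i.succ
    grind
  have hsep : ∀ x y, (x ∈ B ∨ x = lo - 1) → (y ∈ B ∨ y = hi + 1) → x < y →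
      ∃ i, x < a i ∧ a i < y := by
    intro x y hx hy hxy
    -- `z` is the first odd hole after `x`; without a dent in between, `x` and `z` would be
    -- consecutive holes of equal parity.
    obtain ⟨z, hz, hzmin⟩ := ((insert (hi + 1) B).filter fun z => x < z).exists_min_image id
      ⟨y, by simp only [Finset.mem_filter, Finset.mem_insert]; tauto⟩
    simp only [Finset.mem_filter, Finset.mem_insert, id] at hz hzmin
    have hzy : z ≤ y := hzmin y ⟨by tauto, hxy⟩
    by_contra hno
    push Not at hno
    have hx' : lo - 1 ≤ x ∧ x ∉ S ∧ Odd (x - lo) := by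
      rcases hx with hx | rfl
      · exact ⟨by have := hB x hx; omega, fun hh => ((hmem _).1 hh).2.2 hx, (hB x hx).2.2⟩
      · exact ⟨le_rfl, fun hh => by have := ((hmem _).1 hh).1; omega, by grind⟩
    have hz' : z ≤ hi + 1 ∧ z ∉ S ∧ Odd (z - lo) := by
      rcases hz.1 with rfl | hz1
      · exact ⟨le_rfl, fun hh => by have := ((hmem _).1 hh).1; omega, by grind⟩
      · exact ⟨by have := hB z hz1; omega, fun hh => ((hmem _).1 hh).2.2 hz1, (hB z hz1).2.2⟩
    have := h x z hx'.1 hz'.1 hx'.2.1 hz'.2.1 hz.2 fun u h1 h2 => by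
      refine (hmem u).2 ⟨⟨by omega, by omega⟩, ?_, ?_⟩
      · rintro k rfl
        have := hno k h1
        omega
      · intro hu
        have := hzmin u ⟨Or.inr hu, h1⟩
        omega
    have e1 := hx'.2.2
    have e2 := hz'.2.2
    grind
  choose r hrB hr using hex
  refine ⟨r, mem_interlacing.2 fun i => ⟨hr i, (hB _ (hrB i)).2.2⟩, ?_⟩
  refine Finset.Subset.antisymm (fun b hb => ?_) fun b hb => ?_
  · obtain ⟨i, -, rfl⟩ := Finset.mem_image.1 hb
    exact hrB i
  · have hb' := hB b hb
    -- Separation from the sentinels gives dents on both sides of `b`; the last dent to its left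
    -- fixes its gap.
    obtain ⟨i₀, -, h0⟩ := hsep (lo - 1) b (Or.inr rfl) (Or.inl hb) (by omega)
    obtain ⟨k₀, h1, -⟩ := hsep b (hi + 1) (Or.inl hb) (Or.inr rfl) (by omega)
    obtain ⟨i, hi1, himax⟩ := (Finset.univ.filter fun i => a i < b).exists_max_image id
      ⟨i₀, by simpa using h0⟩
    simp only [Finset.mem_filter, Finset.mem_univ, true_and, id] at hi1 himax
    have hik : i < k₀ := ha.lt_iff_lt.1 (hi1.trans h1)
    obtain ⟨i, rfl⟩ := Fin.exists_castSucc_eq.2 (Fin.ne_last_of_lt hik)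
    have hi2 : b < a i.succ := by
      by_contra hle
      have hne : a i.succ ≠ b := by
        rintro rfl
        have := hpar i.succ
        grind
      have := himax i.succ (by omega)
      exact absurd this (not_le.2 Fin.castSucc_lt_succ)
    refine Finset.mem_image.2 ⟨i, Finset.mem_univ _, ?_⟩
    by_contra hne
    rcases lt_or_gt_of_ne hne with hlt | hlt
    · obtain ⟨k, u1, u2⟩ := hsep _ _ (Or.inl (hrB i)) (Or.inl hb) hlt
      exact hstep i k ⟨(hr i).1.trans u1, u2.trans hi2⟩
    · obtain ⟨k, u1, u2⟩ := hsep _ _ (Or.inl hb) (Or.inl (hrB i)) hlt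
      exact hstep i k ⟨hi1.trans u1, u2.trans (hr i).2⟩

theorem image_injOn_interlacing {lo : ℤ} {m : ℕ} {a : Fin (m + 1) → ℤ} (ha : StrictMono a) :
    Set.InjOn (fun r : Fin m → ℤ => Finset.univ.image r) (interlacing lo a : Set (Fin m → ℤ)) := by
  intro r hr r' hr' h
  have h1 := strictMono_of_mem_interlacing ha hr
  have h2 := strictMono_of_mem_interlacing ha hr'
  refine (h1.range_inj h2).1 ?_
  have := congrArg (fun s : Finset ℤ => (s : Set ℤ)) h
  simpa using this

/-- Summing over the ways in which vertical lozenges can stick out of a row with given dents. -/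
theorem sum_tilingGF_row {K : Type*} [Field K] (q : K) (j : ℤ) {lo hi : ℤ} {m : ℕ}
    {a : Fin (m + 1) → ℤ} (ha : StrictMono a) (hpar : ∀ i, Even (a i - lo))
    (hhi : Even (hi - lo)) (hrange : ∀ i, lo ≤ a i ∧ a i ≤ hi) (f : Finset ℤ → K) :
    ∑ B ∈ ((Finset.Icc lo hi).filter fun b => Odd (b - lo)).powerset,
      f B * tilingGF q (rowTriangles j ((Finset.Icc lo hi \ Finset.univ.image a) \ B)) =
    ∑ r ∈ interlacing lo a, f (Finset.univ.image r) := by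
  classical
  have hlohi : lo ≤ hi := (hrange 0).1.trans (hrange 0).2
  obtain ⟨n, hn⟩ := Int.eq_ofNat_of_zero_le (show 0 ≤ hi + 1 - lo by omega)
  have hn' : hi + 1 = lo - 1 + 1 + n := by omega
  rw [← Finset.sum_image (f := f) (image_injOn_interlacing (lo := lo) ha)]
  have key : ∀ B, tilingGF q (rowTriangles j ((Finset.Icc lo hi \ Finset.univ.image a) \ B)) =
      if OddGaps (lo - 1) (hi + 1) ((Finset.Icc lo hi \ Finset.univ.image a) \ B)
        then 1 else 0 := by
    intro B
    rw [hn']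
    refine tilingGF_row q j (lo - 1) n _ fun u hu => ?_
    simp only [Finset.mem_sdiff, Finset.mem_Icc] at hu
    rw [Finset.mem_Ioo]
    omega
  simp only [key, mul_ite, mul_one, mul_zero]
  rw [← Finset.sum_filter]
  refine Finset.sum_congr ?_ fun _ _ => rfl
  ext B
  simp only [Finset.mem_filter, Finset.mem_powerset, Finset.mem_image]
  constructor
  · rintro ⟨h1, h2⟩
    refine exists_interlacing_of_oddGaps ha hpar hhi hrange (fun b hb => ?_) h2
    have := h1 hb
    simpa [and_assoc] using this
  · rintro ⟨r, hr, rfl⟩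
    refine ⟨fun b hb => ?_, oddGaps_of_mem_interlacing ha hpar hhi hrange hr⟩
    obtain ⟨i, -, rfl⟩ := Finset.mem_image.1 hb
    rw [mem_interlacing] at hr
    rw [Finset.mem_filter, Finset.mem_Icc]
    have h1 := hr i
    have h2 := hrange i.castSucc
    have h3 := hrange i.succ
    exact ⟨by omega, h1.2⟩

/-! ### Symmetric q-numbers and central factorials -/

section QNumber

variable {K : Type*} [Field K] {q : K}

open Classical in
/-- The symmetric `q`-number `(q^m - q^(-m)) / (q - q^(-1))`, extended by continuity. -/
noncomputable def qNumber (q : K) (m : ℤ) : K :=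
  if q = q⁻¹ then m * q ^ (m - 1) else (q ^ m - q ^ (-m)) / (q - q⁻¹)

theorem zpow_neg_of_eq_inv (h : q = q⁻¹) (m : ℤ) : q ^ (-m) = q ^ m := by
  conv_rhs => rw [h, inv_zpow']

theorem qNumber_zero (q : K) : qNumber q 0 = 0 := by simp [qNumber]

theorem qNumber_one (q : K) : qNumber q 1 = 1 := by
  rw [qNumber]
  split_ifs with h
  · simp
  · simpa using div_self (sub_ne_zero.2 h)

theorem qNumber_mul (q : K) (m : ℤ) : qNumber q m * (q - q⁻¹) = q ^ m - q ^ (-m) := by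
  rw [qNumber]
  split_ifs with h
  · rw [zpow_neg_of_eq_inv h, ← h]; simp
  · exact div_mul_cancel₀ _ (sub_ne_zero.2 h)

theorem qNumber_neg (hq : q ≠ 0) (m : ℤ) : qNumber q (-m) = -qNumber q m := by
  rw [qNumber, qNumber]
  split_ifs with h
  · have : q ^ (-m - 1) = q ^ (m - 1) := by
      rw [zpow_sub₀ hq, zpow_sub₀ hq, zpow_neg_of_eq_inv h]
    rw [this]; push_cast; ring
  · rw [neg_neg]; ring

/-- With this law proved for `q = q⁻¹` as well, the later identities need no case distinction, so `q
= ±1` is covered. -/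
theorem qNumber_add (hq : q ≠ 0) (m n : ℤ) :
    qNumber q (m + n) = q ^ m * qNumber q n + q ^ (-n) * qNumber q m := by
  simp only [qNumber]
  split_ifs with h
  · rw [zpow_neg_of_eq_inv h, zpow_sub₀ hq, zpow_sub₀ hq, zpow_sub₀ hq, zpow_add₀ hq]
    push_cast; ring
  · rw [mul_div_assoc', mul_div_assoc', ← add_div, neg_add, zpow_add₀ hq, zpow_add₀ hq]
    ring

theorem qNumber_add_sub_qNumber_sub (hq : q ≠ 0) (r a : ℤ) :
    qNumber q (r + a) - qNumber q (r - a) = qNumber q a * (q ^ r + q ^ (-r)) := by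
  rw [qNumber_add hq, show r - a = -a + r by ring, qNumber_add hq, qNumber_neg hq]
  ring

theorem qNumber_add_mul_qNumber_sub (hq : q ≠ 0) (r a : ℤ) :
    qNumber q (r + a) * qNumber q (r - a) = qNumber q r ^ 2 - qNumber q a ^ 2 := by
  have h1 := qNumber_mul q r
  have h2 := qNumber_mul q a
  have e1 : q ^ r * q ^ (-r) = 1 := by rw [← zpow_add₀ hq]; simp
  have e2 : q ^ a * q ^ (-a) = 1 := by rw [← zpow_add₀ hq]; simp
  rw [qNumber_add hq, sub_eq_add_neg, qNumber_add hq, qNumber_neg hq, neg_neg]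
  generalize q ^ r = R at *
  generalize q ^ (-r) = R' at *
  generalize q ^ a = A at *
  generalize q ^ (-a) = A' at *
  generalize qNumber q r = x at *
  generalize qNumber q a = y at *
  linear_combination x ^ 2 * e2 - x * y * R * h2 + y ^ 2 * R * h1 - y ^ 2 * e1

theorem qNumber_natCast (hq : q ≠ 0) (m : ℕ) :
    qNumber q m = q ^ (1 - (m : ℤ)) * qInt (q ^ 2) m := by
  induction m with
  | zero => simp [qInt, qNumber_zero]
  | succ m ih =>
    have e : q ^ (m : ℤ) = q ^ (-(m : ℤ)) * (q ^ 2) ^ m := by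
      rw [← pow_mul, ← zpow_natCast q (2 * m), ← zpow_add₀ hq]
      congr 1; push_cast; ring
    have hs : qInt (q ^ 2) (m + 1) = qInt (q ^ 2) m + (q ^ 2) ^ m := Finset.sum_range_succ _ _
    rw [Nat.cast_succ, qNumber_add hq, qNumber_one, ih, hs, e,
      sub_add_cancel_right, sub_eq_add_neg, zpow_add₀ hq]
    simp only [zpow_neg, zpow_one]
    field_simp
    ring

/-- The monic polynomial of degree `k` in `[t]^2` that vanishes at `t = 1, 3, …, 2 k - 1`. -/
noncomputable def oddProd (q : K) (k : ℕ) (t : ℤ) : K :=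
  ∏ l ∈ Finset.range k, (qNumber q t ^ 2 - qNumber q (2 * l + 1) ^ 2)

/-- `[t]` times the monic polynomial of degree `k` in `[t]^2` that vanishes at
`t = 2, 4, …, 2 k`. -/
noncomputable def evenProd (q : K) (k : ℕ) (t : ℤ) : K :=
  qNumber q t * ∏ l ∈ Finset.range k, (qNumber q t ^ 2 - qNumber q (2 * l + 2) ^ 2)

theorem oddProd_succ (q : K) (k : ℕ) (t : ℤ) :
    oddProd q (k + 1) t = oddProd q k t * (qNumber q t ^ 2 - qNumber q (2 * k + 1) ^ 2) :=
  Finset.prod_range_succ _ _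

theorem evenProd_succ (q : K) (k : ℕ) (t : ℤ) :
    evenProd q (k + 1) t = evenProd q k t * (qNumber q t ^ 2 - qNumber q (2 * k + 2) ^ 2) := by
  rw [evenProd, Finset.prod_range_succ, ← mul_assoc]; rfl

theorem evenProd_zero_right (q : K) (k : ℕ) : evenProd q k 0 = 0 := by
  simp [evenProd, qNumber_zero]

/-- By difference of squares, `evenProd q k t` is the product of `[t + 2l]` for `|l| ≤ k`, and
`oddProd q k t` that of `[t + u]` for odd `|u| < 2k`. A unit shift makes the factors agree except
for one at the end. -/
theorem evenProd_add_one (hq : q ≠ 0) (k : ℕ) (t : ℤ) :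
    evenProd q k (t + 1) = qNumber q (t + (2 * k + 1)) * oddProd q k t := by
  induction k with
  | zero => simp [evenProd, oddProd]
  | succ k ih =>
    rw [evenProd_succ, oddProd_succ, ih, ← qNumber_add_mul_qNumber_sub hq,
      ← qNumber_add_mul_qNumber_sub hq,
      show t + 1 + (2 * (k : ℤ) + 2) = t + (2 * (k + 1 : ℕ) + 1) by push_cast; ring,
      show t + 1 - (2 * (k : ℤ) + 2) = t - (2 * k + 1) by ring]
    ring

theorem evenProd_sub_one (hq : q ≠ 0) (k : ℕ) (t : ℤ) :
    evenProd q k (t - 1) = qNumber q (t - (2 * k + 1)) * oddProd q k t := by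
  induction k with
  | zero => simp [evenProd, oddProd]
  | succ k ih =>
    rw [evenProd_succ, oddProd_succ, ih, ← qNumber_add_mul_qNumber_sub hq,
      ← qNumber_add_mul_qNumber_sub hq,
      show t - 1 - (2 * (k : ℤ) + 2) = t - (2 * (k + 1 : ℕ) + 1) by push_cast; ring,
      show t - 1 + (2 * (k : ℤ) + 2) = t + (2 * k + 1) by ring]
    ring

theorem oddProd_succ_add_one (hq : q ≠ 0) (k : ℕ) (t : ℤ) :
    oddProd q (k + 1) (t + 1) = qNumber q (t + (2 * k + 2)) * evenProd q k t := by
  induction k with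
  | zero =>
    rw [oddProd_succ, ← qNumber_add_mul_qNumber_sub hq]
    simp [evenProd, oddProd, add_assoc]
  | succ k ih =>
    rw [oddProd_succ, evenProd_succ, ih, ← qNumber_add_mul_qNumber_sub hq,
      ← qNumber_add_mul_qNumber_sub hq,
      show t + 1 + (2 * ((k + 1 : ℕ) : ℤ) + 1) = t + (2 * (k + 1 : ℕ) + 2) by push_cast; ring,
      show t + 1 - (2 * ((k + 1 : ℕ) : ℤ) + 1) = t - (2 * k + 2) by push_cast; ring]
    ring

theorem oddProd_succ_sub_one (hq : q ≠ 0) (k : ℕ) (t : ℤ) :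
    oddProd q (k + 1) (t - 1) = qNumber q (t - (2 * k + 2)) * evenProd q k t := by
  induction k with
  | zero =>
    rw [oddProd_succ, ← qNumber_add_mul_qNumber_sub hq]
    simp only [oddProd, evenProd, Finset.range_zero, Finset.prod_empty]
    rw [show t - 1 + (2 * ((0 : ℕ) : ℤ) + 1) = t by push_cast; ring,
      show t - 1 - (2 * ((0 : ℕ) : ℤ) + 1) = t - (2 * ((0 : ℕ) : ℤ) + 2) by push_cast; ring]
    ring
  | succ k ih =>
    rw [oddProd_succ, evenProd_succ, ih, ← qNumber_add_mul_qNumber_sub hq,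
      ← qNumber_add_mul_qNumber_sub hq,
      show t - 1 - (2 * ((k + 1 : ℕ) : ℤ) + 1) = t - (2 * (k + 1 : ℕ) + 2) by push_cast; ring,
      show t - 1 + (2 * ((k + 1 : ℕ) : ℤ) + 1) = t + (2 * k + 2) by push_cast; ring]
    ring

/-- The discrete antiderivative of lozenge weight times `oddProd q k`: the shifts by `±1` share the
factor `oddProd q k t`, and their end factors differ by `[2k+1] (q^t + q^(-t))`. -/
theorem evenProd_sub (hq : q ≠ 0) (h2 : (2 : K) ≠ 0) (k : ℕ) (t : ℤ) :
    evenProd q k (t + 1) - evenProd q k (t - 1) =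
      2 * qNumber q (2 * k + 1) * ((q ^ t + q ^ (-t)) / 2 * oddProd q k t) := by
  rw [evenProd_add_one hq, evenProd_sub_one hq, ← sub_mul, qNumber_add_sub_qNumber_sub hq]
  field_simp

theorem oddProd_succ_sub (hq : q ≠ 0) (h2 : (2 : K) ≠ 0) (k : ℕ) (t : ℤ) :
    oddProd q (k + 1) (t + 1) - oddProd q (k + 1) (t - 1) =
      2 * qNumber q (2 * k + 2) * ((q ^ t + q ^ (-t)) / 2 * evenProd q k t) := by
  rw [oddProd_succ_add_one hq, oddProd_succ_sub_one hq, ← sub_mul, qNumber_add_sub_qNumber_sub hq]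
  field_simp

end QNumber

/-! ### Summing determinants over interlacing sequences -/

theorem sum_Ioo_odd_telescope {M : Type*} [AddCommGroup M] (F : ℤ → M) {lo a a' : ℤ}
    (h : a ≤ a') (ha : Even (a - lo)) (ha' : Even (a' - lo)) :
    ∑ b ∈ (Finset.Ioo a a').filter (fun b => Odd (b - lo)), (F (b + 1) - F (b - 1)) =
      F a' - F a := by
  obtain ⟨n, rfl⟩ : ∃ n : ℕ, a' = a + 2 * n := by
    obtain ⟨u, hu⟩ := ha
    obtain ⟨v, hv⟩ := ha'
    exact ⟨(v - u).toNat, by omega⟩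
  clear h ha'
  induction n with
  | zero => simp
  | succ n ih =>
    have e : (Finset.Ioo a (a + 2 * (n + 1 : ℕ))).filter (fun b => Odd (b - lo)) =
        insert (a + 2 * n + 1) ((Finset.Ioo a (a + 2 * n)).filter (fun b => Odd (b - lo))) := by
      ext b
      simp only [Finset.mem_filter, Finset.mem_Ioo, Finset.mem_insert]
      obtain ⟨u, hu⟩ := ha
      constructor
      · rintro ⟨h1, v, hv⟩
        by_cases hb : b = a + 2 * n + 1
        · exact Or.inl hb
        · exact Or.inr ⟨by push_cast at h1; omega, v, hv⟩
      · rintro (rfl | ⟨h1, h2⟩)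
        · exact ⟨by push_cast; omega, u + n, by omega⟩
        · exact ⟨by push_cast; omega, h2⟩
    rw [e, Finset.sum_insert (by simp), ih,
      show a + 2 * (n : ℤ) + 1 + 1 = a + 2 * ((n + 1 : ℕ) : ℤ) by push_cast; ring,
      add_sub_cancel_right]
    abel

section Determinants

variable {K : Type*} [Field K]

/-- The entries of an interlacing sequence vary independently, each in its own gap. Multilinearity
moves the sum into the rows, where it telescopes; the `c k` leave through the columns. -/
theorem sum_interlacing_det {lo : ℤ} {m : ℕ} {a : Fin (m + 1) → ℤ} (ha : StrictMono a)
    (hpar : ∀ i, Even (a i - lo)) (w : ℤ → K) (g F : ℕ → ℤ → K) (c : ℕ → K)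
    (hc : ∀ k < m, c k ≠ 0)
    (hF : ∀ k t, F k (t + 1) - F k (t - 1) = c k * (w t * g k t)) :
    ∑ r ∈ interlacing lo a, (∏ i, w (r i)) *
        (Matrix.of fun i k : Fin m => g k (r i)).det =
      (∏ k : Fin m, c k)⁻¹ *
        (Matrix.of fun i k : Fin m => F k (a i.succ) - F k (a i.castSucc)).det := by
  have h1 : ∀ r : Fin m → ℤ, (∏ i, w (r i)) * (Matrix.of fun i k : Fin m => g k (r i)).det =
      (Matrix.detRowAlternating (R := K) (n := Fin m)).toMultilinearMap
        (fun i => fun k : Fin m => w (r i) * g k (r i)) := by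
    intro r
    rw [← Matrix.det_mul_column]
    rfl
  simp only [h1, interlacing]
  rw [← MultilinearMap.map_sum_finset _ (fun (_ : Fin m) (b : ℤ) (k : Fin m) => w b * g k b),
    ← Finset.prod_inv_distrib, ← Matrix.det_mul_row]
  change Matrix.det _ = _
  congr 1
  ext i k
  rw [Finset.sum_apply, Matrix.of_apply, Matrix.of_apply,
    ← sum_Ioo_odd_telescope (F k) (ha Fin.castSucc_lt_succ).le (hpar _) (hpar _), Finset.mul_sum]
  refine Finset.sum_congr rfl fun b _ => ?_
  rw [hF, inv_mul_cancel_left₀ (hc k k.isLt)]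

/-- Subtracting from each row its predecessor clears the constant first column below its top entry.
-/
theorem det_eq_det_sub {m : ℕ} (G : ℕ → ℤ → K) (hG : ∀ t, G 0 t = 1) (a : Fin (m + 1) → ℤ) :
    (Matrix.of fun i k : Fin m => G (k + 1) (a i.succ) - G (k + 1) (a i.castSucc)).det =
      (Matrix.of fun i k : Fin (m + 1) => G k (a i)).det := by
  rw [Matrix.det_eq_of_forall_row_eq_smul_add_pred
    (A := Matrix.of fun i k : Fin (m + 1) => G k (a i))
    (B := Matrix.of (Fin.cons (fun k => G k (a 0))
      (fun i k => G k (a i.succ) - G k (a i.castSucc)))) (fun _ => 1) (fun _ => rfl)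
    (fun i k => by simp), Matrix.det_succ_column_zero, Fin.sum_univ_succ]
  simp only [Matrix.of_apply, Fin.cons_zero, Fin.cons_succ, Fin.val_zero, hG, sub_self]
  simp
  rfl

/-- Adjoin a constant function to undo the differences; at the node `0` all other functions vanish,
so expansion along that row removes it. -/
theorem det_sub_cons_zero {m : ℕ} (F : ℕ → ℤ → K) (hF : ∀ k, F k 0 = 0) (r : Fin m → ℤ) :
    (Matrix.of fun i k : Fin m => F k ((Fin.cons 0 r : Fin (m + 1) → ℤ) i.succ) -
        F k ((Fin.cons 0 r : Fin (m + 1) → ℤ) i.castSucc)).det =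
      (Matrix.of fun i k : Fin m => F k (r i)).det := by
  have := det_eq_det_sub (fun k t => match k with | 0 => 1 | k + 1 => F k t) (fun _ => rfl)
    (Fin.cons 0 r : Fin (m + 1) → ℤ)
  refine this.trans ?_
  rw [Matrix.det_succ_row_zero, Fin.sum_univ_succ]
  simp [hF]
  rfl

variable {q : K}

theorem sum_interlacing_det_oddProd (hq : q ≠ 0) (h2 : (2 : K) ≠ 0) {m : ℕ} {r : Fin m → ℤ}
    (hr : StrictMono r) (hpos : ∀ i, 0 < r i) (hpar : ∀ i, Even (r i))
    (hc : ∀ k < m, qNumber q (2 * k + 1) ≠ 0) :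
    ∑ p ∈ interlacing 0 (Fin.cons 0 r : Fin (m + 1) → ℤ), (∏ i, (q ^ p i + q ^ (-p i)) / 2) *
        (Matrix.of fun i k : Fin m => oddProd q k (p i)).det =
      (∏ k : Fin m, 2 * qNumber q (2 * (k : ℕ) + 1))⁻¹ *
        (Matrix.of fun i k : Fin m => evenProd q k (r i)).det := by
  rw [← det_sub_cons_zero (evenProd q) (evenProd_zero_right q)]
  refine sum_interlacing_det (Fin.strictMono_cons.2 ⟨?_, hr⟩) ?_ (fun t => (q ^ t + q ^ (-t)) / 2)
    (oddProd q) (evenProd q) (fun k => 2 * qNumber q (2 * k + 1))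
    (fun k hk => mul_ne_zero h2 (hc k hk)) (evenProd_sub hq h2)
  · intro i; exact hpos i
  · intro i
    refine Fin.cases ?_ (fun i => ?_) i
    · simp
    · simpa using hpar i

theorem sum_interlacing_det_evenProd (hq : q ≠ 0) (h2 : (2 : K) ≠ 0) {m : ℕ}
    {a : Fin (m + 1) → ℤ} (ha : StrictMono a) (hpar : ∀ i, Even (a i - 1))
    (hc : ∀ k < m, qNumber q (2 * k + 2) ≠ 0) :
    ∑ r ∈ interlacing 1 a, (∏ i, (q ^ r i + q ^ (-r i)) / 2) *
        (Matrix.of fun i k : Fin m => evenProd q k (r i)).det =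
      (∏ k : Fin m, 2 * qNumber q (2 * (k : ℕ) + 2))⁻¹ *
        (Matrix.of fun i k : Fin (m + 1) => oddProd q k (a i)).det := by
  rw [← det_eq_det_sub (oddProd q) (fun _ => by simp [oddProd])]
  exact sum_interlacing_det ha hpar (fun t => (q ^ t + q ^ (-t)) / 2)
    (evenProd q) (fun k => oddProd q (k + 1)) (fun k => 2 * qNumber q (2 * k + 2))
    (fun k hk => mul_ne_zero h2 (hc k hk)) (oddProd_succ_sub hq h2)

/-- Monic polynomials of degrees `0, 1, …` in `[a i]^2` give the Vandermonde determinant. -/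
theorem det_oddProd (q : K) {m : ℕ} (a : Fin m → ℤ) :
    (Matrix.of fun i k : Fin m => oddProd q k (a i)).det =
      ∏ i : Fin m, ∏ j ∈ Finset.Ioi i, (qNumber q (a j) ^ 2 - qNumber q (a i) ^ 2) := by
  rw [← Matrix.det_vandermonde (fun i => qNumber q (a i) ^ 2),
    Matrix.det_eval_matrixOfPolynomials_eq_det_vandermonde _ (fun k : Fin m =>
      ∏ l ∈ Finset.range k, (Polynomial.X - Polynomial.C (qNumber q (2 * l + 1) ^ 2)))
      (fun k => by
        rw [Polynomial.natDegree_prod_of_monic _ _ fun l _ => Polynomial.monic_X_sub_C _]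
        simp only [Polynomial.natDegree_X_sub_C]
        simp)
      (fun k => Polynomial.monic_prod_of_monic _ _ fun l _ => Polynomial.monic_X_sub_C _)]
  congr 1
  ext i k
  simp [oddProd, Polynomial.eval_prod]

end Determinants

/-! ### Row recursion for dented trapezoids -/

/-- The part of the trapezoid in the rows `j, …, H - 1`, with dents at the abscissae in `A` along
the bottom row. -/
noncomputable def dentedTrapezoid (L H j : ℤ) (A : Finset ℤ) : Finset UnitTriangle :=
  ((Finset.Icc 1 L ×ˢ Finset.Ico j H).filter fun t => t.1 + t.2 ≤ L) \ A.image fun a => (a, j)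

theorem mem_dentedTrapezoid {L H j : ℤ} {A : Finset ℤ} {t : UnitTriangle} :
    t ∈ dentedTrapezoid L H j A ↔
      1 ≤ t.1 ∧ t.1 ≤ L ∧ j ≤ t.2 ∧ t.2 < H ∧ t.1 + t.2 ≤ L ∧ ¬ (t.1 ∈ A ∧ t.2 = j) := by
  have : t ∈ A.image (fun a => (a, j)) ↔ t.1 ∈ A ∧ t.2 = j := mem_rowTriangles
  simp only [dentedTrapezoid, Finset.mem_sdiff, Finset.mem_filter, Finset.mem_product,
    Finset.mem_Icc, Finset.mem_Ico, this]
  tauto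

theorem dentedTrapezoid_eq_union {L H j : ℤ} (hj : 0 ≤ j) (hjH : j < H) (A : Finset ℤ) :
    dentedTrapezoid L H j A =
      rowTriangles j (Finset.Icc 1 (L - j) \ A) ∪ dentedTrapezoid L H (j + 1) ∅ := by
  ext ⟨a, b⟩
  simp only [Finset.mem_union, mem_dentedTrapezoid, mem_rowTriangles, Finset.mem_sdiff,
    Finset.mem_Icc, Finset.notMem_empty, false_and, not_false_eq_true, and_true]
  by_cases hb : b = j <;> by_cases ha : a ∈ A <;> grind

section

variable {K : Type*} [Field K] (q : K) {L H j : ℤ}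

theorem tilingGF_dentedTrapezoid (hL : Odd L) (hj : 0 ≤ j) (hjH : j + 1 < H) {A : Finset ℤ}
    (hA : ∀ a ∈ A, Odd (a + j)) :
    tilingGF q (dentedTrapezoid L H j A) =
      ∑ B ∈ ((Finset.Icc 1 (L - j)).filter fun b => Even (b + j)).powerset,
        (∏ b ∈ B, (q ^ b + q ^ (-b)) / 2) * tilingGF q (dentedTrapezoid L H (j + 1) B) *
          tilingGF q (rowTriangles j ((Finset.Icc 1 (L - j) \ A) \ B)) := by
  rw [dentedTrapezoid_eq_union hj (by omega), tilingGF_union q (j := j)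
    (P := (Finset.Icc 1 (L - j)).filter fun b => Even (b + j))]
  · refine Finset.sum_congr rfl fun B _ => ?_
    have e1 : rowTriangles j (Finset.Icc 1 (L - j) \ A) \ B.image (fun b => (b, j)) =
        rowTriangles j ((Finset.Icc 1 (L - j) \ A) \ B) := by
      ext t
      have : t ∈ B.image (fun b => (b, j)) ↔ t.1 ∈ B ∧ t.2 = j := mem_rowTriangles
      rw [Finset.mem_sdiff, this, mem_rowTriangles, mem_rowTriangles, Finset.mem_sdiff (t := B)]
      tauto
    have e2 : dentedTrapezoid L H (j + 1) ∅ \ B.image (fun b => (b, j + 1)) =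
        dentedTrapezoid L H (j + 1) B := by
      simp [dentedTrapezoid]
    rw [e1, e2]
    ring
  · intro t ht
    exact (mem_rowTriangles.1 ht).2
  · intro t ht
    have := (mem_dentedTrapezoid.1 ht).2.2.1
    omega
  · intro b
    simp only [Finset.mem_filter, Finset.mem_Icc, mem_rowTriangles, Finset.mem_sdiff,
      mem_dentedTrapezoid, Finset.notMem_empty, not_false_eq_true, and_true]
    constructor
    · rintro ⟨h1, h2⟩
      have hbA : b ∉ A := fun h => by have := hA b h; grind
      -- Row `j + 1` ends one position earlier; since `L` is odd, row `j` ends in an up triangle, so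
      -- no vertical lozenge is lost there.
      have : b + j ≠ L := by rintro rfl; grind
      exact ⟨⟨h1, hbA⟩, by omega, h2⟩
    · rintro ⟨⟨h1, -⟩, -, h2⟩
      exact ⟨h1, h2⟩

theorem prod_image_of_mem_interlacing {lo : ℤ} {m : ℕ} {a : Fin (m + 1) → ℤ} (ha : StrictMono a)
    {r : Fin m → ℤ} (hr : r ∈ interlacing lo a) (w : ℤ → K) :
    ∏ b ∈ Finset.univ.image r, w b = ∏ i, w (r i) :=
  Finset.prod_image fun _ _ _ _ h => (strictMono_of_mem_interlacing ha hr).injective h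

theorem tilingGF_dentedTrapezoid_of_even (hL : Odd L) (hj : 0 ≤ j) (hj2 : Even j)
    (hjH : j + 1 < H) {m : ℕ} {a : Fin (m + 1) → ℤ} (ha : StrictMono a)
    (hpar : ∀ i, Even (a i - 1)) (hrange : ∀ i, 1 ≤ a i ∧ a i ≤ L - j) :
    tilingGF q (dentedTrapezoid L H j (Finset.univ.image a)) =
      ∑ r ∈ interlacing 1 a, (∏ i, (q ^ r i + q ^ (-r i)) / 2) *
        tilingGF q (dentedTrapezoid L H (j + 1) (Finset.univ.image r)) := by
  rw [tilingGF_dentedTrapezoid q hL hj hjH]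
  · have e : ((Finset.Icc 1 (L - j)).filter fun b => Even (b + j)) =
        (Finset.Icc 1 (L - j)).filter fun b => Odd (b - 1) := by
      refine Finset.filter_congr fun b _ => ?_
      grind
    rw [e, sum_tilingGF_row q j ha hpar (by grind) hrange fun B =>
      (∏ b ∈ B, (q ^ b + q ^ (-b)) / 2) * tilingGF q (dentedTrapezoid L H (j + 1) B)]
    refine Finset.sum_congr rfl fun r hr => ?_
    rw [prod_image_of_mem_interlacing ha hr fun b => (q ^ b + q ^ (-b)) / 2]
  · intro b hb
    obtain ⟨i, -, rfl⟩ := Finset.mem_image.1 hb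
    have := hpar i
    grind

/-- An odd row starts with a down triangle at abscissa `1`, so a vertical lozenge also fits left of
the first dent. A phantom dent at `0`, outside the row, reduces this to the interlacing pattern. -/
theorem tilingGF_dentedTrapezoid_of_odd (hL : Odd L) (hj : 0 ≤ j) (hj2 : Odd j)
    (hjH : j + 1 < H) (hjL : j ≤ L) {m : ℕ} {r : Fin m → ℤ} (hr : StrictMono r)
    (hpar : ∀ i, Even (r i)) (hrange : ∀ i, 0 < r i ∧ r i ≤ L - j) :
    tilingGF q (dentedTrapezoid L H j (Finset.univ.image r)) =
      ∑ p ∈ interlacing 0 (Fin.cons 0 r : Fin (m + 1) → ℤ),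
        (∏ i, (q ^ p i + q ^ (-p i)) / 2) *
          tilingGF q (dentedTrapezoid L H (j + 1) (Finset.univ.image p)) := by
  have ha : StrictMono (Fin.cons 0 r : Fin (m + 1) → ℤ) :=
    Fin.strictMono_cons.2 ⟨fun i => (hrange i).1, hr⟩
  rw [tilingGF_dentedTrapezoid q hL hj hjH]
  · have e : ((Finset.Icc 1 (L - j)).filter fun b => Even (b + j)) =
        (Finset.Icc 0 (L - j)).filter fun b => Odd (b - 0) := by
      ext b
      simp only [Finset.mem_filter, Finset.mem_Icc, sub_zero]
      constructor
      · rintro ⟨h1, h2⟩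
        exact ⟨by omega, by grind⟩
      · rintro ⟨h1, h2⟩
        have : b ≠ 0 := by rintro rfl; simp at h2
        exact ⟨by omega, by grind⟩
    have e' : Finset.Icc 1 (L - j) \ Finset.univ.image r =
        Finset.Icc 0 (L - j) \ Finset.univ.image (Fin.cons 0 r : Fin (m + 1) → ℤ) := by
      ext b
      simp only [Finset.mem_sdiff, Finset.mem_Icc, Finset.mem_image, Finset.mem_univ, true_and,
        Fin.exists_fin_succ, Fin.cons_zero, Fin.cons_succ, not_or]
      constructor
      · rintro ⟨h1, h2⟩
        exact ⟨by omega, by omega, h2⟩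
      · rintro ⟨h1, h2, h3⟩
        exact ⟨by omega, h3⟩
    rw [e, e', sum_tilingGF_row q j ha ?_ (by grind) ?_ fun B =>
      (∏ b ∈ B, (q ^ b + q ^ (-b)) / 2) * tilingGF q (dentedTrapezoid L H (j + 1) B)]
    · refine Finset.sum_congr rfl fun p hp => ?_
      rw [prod_image_of_mem_interlacing ha hp fun b => (q ^ b + q ^ (-b)) / 2]
    · intro i
      refine Fin.cases ?_ (fun i => ?_) i
      · simp
      · simpa using hpar i
    · intro i
      refine Fin.cases ?_ (fun i => ?_) i
      · simpa using hjL
      · simpa using ⟨(hrange i).1.le, (hrange i).2⟩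
  · intro b hb
    obtain ⟨i, -, rfl⟩ := Finset.mem_image.1 hb
    have := hpar i
    grind

theorem tilingGF_row_single {a : Fin 1 → ℤ} (hL : Odd L) (hj2 : Even j)
    (hpar : ∀ i, Even (a i - 1)) (hrange : ∀ i, 1 ≤ a i ∧ a i ≤ L - j) :
    tilingGF q (rowTriangles j (Finset.Icc 1 (L - j) \ Finset.univ.image a)) = 1 := by
  -- With `f` the indicator of `∅`, the sum reduces to the row with no lozenge sticking out; only
  -- the empty sequence interlaces with a single dent.
  have := sum_tilingGF_row q j (Subsingleton.strictMono a) hpar (hi := L - j) (by grind) hrange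
    fun B => if B = ∅ then 1 else 0
  rw [Finset.sum_eq_single ∅] at this
  · simpa [interlacing] using this
  · intro B _ hB
    simp [hB]
  · simp

/-- Induction on the number of dents, removing an even and an odd row at a time. The odd row turns
`oddProd` into `evenProd` in the same size; the even row turns it back, enlarging the determinant by
one. -/
theorem tilingGF_dentedTrapezoid_eq_det {q : K} (hq : q ≠ 0) (h2 : (2 : K) ≠ 0) (hL : Odd L)
    (m : ℕ) (hc : ∀ k : ℕ, 1 ≤ k → k ≤ 2 * m - 2 → qNumber q k ≠ 0) (hj : 0 ≤ j) (hj2 : Even j)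
    (hH : H = j + 2 * m - 1)
    {a : Fin m → ℤ} (ha : StrictMono a)
    (hpar : ∀ i, Even (a i - 1)) (hrange : ∀ i, 1 ≤ a i ∧ a i ≤ L - j) :
    tilingGF q (dentedTrapezoid L H j (Finset.univ.image a)) =
      (∏ n ∈ Finset.range m, ∏ k ∈ Finset.range n,
        (4 * qNumber q (2 * k + 1) * qNumber q (2 * k + 2)))⁻¹ *
      (Matrix.of fun i k : Fin m => oddProd q k (a i)).det := by
  induction m generalizing j with
  | zero =>
    have : dentedTrapezoid L H j (Finset.univ.image a) = ∅ := by
      refine Finset.eq_empty_of_forall_notMem fun t ht => ?_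
      have := mem_dentedTrapezoid.1 ht
      push_cast at hH
      omega
    rw [this, tilingGF_empty]
    simp
  | succ m ih =>
    -- A single dent means a single row, with no second row to split off.
    rcases Nat.eq_zero_or_pos m with rfl | hm
    · have : dentedTrapezoid L H (j + 1) ∅ = ∅ := by
        refine Finset.eq_empty_of_forall_notMem fun t ht => ?_
        have := mem_dentedTrapezoid.1 ht
        push_cast at hH
        omega
      rw [dentedTrapezoid_eq_union hj (by push_cast at hH; omega), this, Finset.union_empty,
        tilingGF_row_single q hL hj2 hpar hrange]
      simp [oddProd]
    -- Two distinct dents in `[1, L - j]` leave row `j + 1` nonempty.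
    · have hjL : j + 2 ≤ L := by
        have h0 := hrange 0
        have h1 := hrange ⟨1, by omega⟩
        have h2 : a 0 < a ⟨1, by omega⟩ := ha (by simp [Fin.lt_def])
        grind
      rw [tilingGF_dentedTrapezoid_of_even q hL hj hj2 (by push_cast at hH; omega) ha hpar hrange]
      have key : ∀ r ∈ interlacing 1 a,
          tilingGF q (dentedTrapezoid L H (j + 1) (Finset.univ.image r)) =
          (∏ n ∈ Finset.range m, ∏ k ∈ Finset.range n,
            (4 * qNumber q (2 * k + 1) * qNumber q (2 * k + 2)))⁻¹ *
          ((∏ k : Fin m, 2 * qNumber q (2 * (k : ℕ) + 1))⁻¹ *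
            (Matrix.of fun i k : Fin m => evenProd q k (r i)).det) := by
        intro r hr
        have hmono := strictMono_of_mem_interlacing ha hr
        rw [mem_interlacing] at hr
        have hrpar : ∀ i, Even (r i) := fun i => by have := (hr i).2; grind
        have hrpos : ∀ i, 0 < r i ∧ r i ≤ L - (j + 1) := fun i => by
          have h1 := hr i
          have h2 := hrange i.castSucc
          have h3 := hrange i.succ
          omega
        rw [tilingGF_dentedTrapezoid_of_odd q hL (by omega) (by grind)
          (by push_cast at hH; omega) (by omega) hmono hrpar hrpos,
          ← sum_interlacing_det_oddProd hq h2 hmono (fun i => (hrpos i).1) hrpar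
            (fun k hk => by
              have := hc (2 * k + 1) (by omega) (by omega)
              exact_mod_cast this), Finset.mul_sum]
        refine Finset.sum_congr rfl fun p hp => ?_
        have hpmono := strictMono_of_mem_interlacing
          (Fin.strictMono_cons.2 ⟨fun i => (hrpos i).1, hmono⟩) hp
        rw [mem_interlacing] at hp
        rw [add_assoc, ih (fun k h1 h2 => hc k h1 (by omega)) (by omega) (by grind)
          (by push_cast at hH; omega) hpmono]
        · ring
        · intro i
          have := (hp i).2
          grind
        · intro i
          have h1 := (hp i).1
          have h2 := (hp i).2
          have h3 := hrpos i
          have h4 : (0 : ℤ) ≤ (Fin.cons 0 r : Fin (m + 1) → ℤ) i.castSucc := by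
            refine Fin.cases ?_ (fun i => ?_) i.castSucc
            · simp
            · simpa using (hrpos i).1.le
          rw [Fin.cons_succ] at h1
          omega
      rw [Finset.sum_congr rfl fun r hr => by rw [key r hr]]
      have hsum := sum_interlacing_det_evenProd hq h2 ha hpar fun k hk => by
        have := hc (2 * k + 2) (by omega) (by omega)
        exact_mod_cast this
      have e : ∀ u v : K, ∑ r ∈ interlacing 1 a, (∏ i, (q ^ r i + q ^ (-r i)) / 2) *
          (u * (v * (Matrix.of fun i k : Fin m => evenProd q k (r i)).det)) =
          u * v * ∑ r ∈ interlacing 1 a, (∏ i, (q ^ r i + q ^ (-r i)) / 2) *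
            (Matrix.of fun i k : Fin m => evenProd q k (r i)).det := by
        intro u v
        rw [Finset.mul_sum]
        exact Finset.sum_congr rfl fun r _ => by ring
      have hprod : (∏ k : Fin m, 2 * qNumber q (2 * (k : ℕ) + 1)) *
          (∏ k : Fin m, 2 * qNumber q (2 * (k : ℕ) + 2)) =
          ∏ k ∈ Finset.range m, (4 * qNumber q (2 * k + 1) * qNumber q (2 * k + 2)) := by
        rw [← Finset.prod_mul_distrib, Finset.prod_range]
        exact Finset.prod_congr rfl fun k _ => by ring
      rw [e, hsum, Finset.prod_range_succ _ m, ← hprod, mul_inv, mul_inv]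
      ring

end

/-! ### From the determinant to the product formula -/

theorem quarteredHexagon_eq_dentedTrapezoid (x : ℕ) {n : ℕ} (s : Fin n → ℕ) :
    quarteredHexagon x s = dentedTrapezoid (2 * (x + n) - 1) (2 * n - 1) 0
      (Finset.univ.image fun i => 2 * (s i : ℤ) - 1) := by
  rw [quarteredHexagon, trapezoid, dentedTrapezoid, Finset.image_image]
  rfl

theorem prod_zpow_eq_zpow_sum {ι K : Type*} [Field K] {q : K} (hq : q ≠ 0) (s : Finset ι)
    (e : ι → ℤ) : ∏ i ∈ s, q ^ e i = q ^ ∑ i ∈ s, e i := by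
  classical
  induction s using Finset.induction_on with
  | empty => simp
  | insert i s hi ih => rw [Finset.prod_insert hi, Finset.sum_insert hi, zpow_add₀ hq, ih]

theorem Fin.prod_Iio_val {M : Type*} [CommMonoid M] {n : ℕ} (j : Fin n) (f : ℕ → M) :
    ∏ i ∈ Finset.Iio j, f i = ∏ i ∈ Finset.range j, f i := by
  rw [← Nat.Iio_eq_range, ← Fin.map_valEmbedding_Iio, Finset.prod_map]
  rfl

theorem Fin.prod_prod_Ioi_comm {M : Type*} [CommMonoid M] {n : ℕ} (f : Fin n → Fin n → M) :
    ∏ i : Fin n, ∏ j ∈ Finset.Ioi i, f i j = ∏ j : Fin n, ∏ i ∈ Finset.Iio j, f i j :=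
  Finset.prod_comm' fun i j => by simp

section

variable {K : Type*} [Field K] {q : K}

/-- Since `[m] = q^(1-m) [m]_{q^2}`, the exponent is minus the sum of `m - 1` over `1 ≤ m ≤ 2n`. -/
theorem prod_qNumber_eq_qFactorial (hq : q ≠ 0) (n : ℕ) :
    ∏ k ∈ Finset.range n, (4 * qNumber q (2 * k + 1) * qNumber q (2 * k + 2)) =
      (2 : K) ^ (2 * n) * q ^ (-((n : ℤ) * (2 * n - 1))) * qFactorial (q ^ 2) (2 * n) := by
  induction n with
  | zero => simp [qFactorial]
  | succ n ih =>
    have h1 := qNumber_natCast hq (2 * n + 1)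
    have h2 := qNumber_natCast hq (2 * n + 2)
    have h3 : qFactorial (q ^ 2) (2 * (n + 1)) =
        qFactorial (q ^ 2) (2 * n) * qInt (q ^ 2) (2 * n + 1) * qInt (q ^ 2) (2 * n + 2) := by
      rw [qFactorial, show 2 * (n + 1) = 2 * n + 1 + 1 by ring, Finset.prod_range_succ,
        Finset.prod_range_succ]
      rfl
    have h4 : q ^ (-(((n + 1 : ℕ) : ℤ) * (2 * (n + 1 : ℕ) - 1))) =
        q ^ (-((n : ℤ) * (2 * n - 1))) * q ^ (1 - ((2 * n + 1 : ℕ) : ℤ)) *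
          q ^ (1 - ((2 * n + 2 : ℕ) : ℤ)) := by
      rw [← zpow_add₀ hq, ← zpow_add₀ hq]
      congr 1; push_cast; ring
    push_cast at h1 h2
    rw [Finset.prod_range_succ, ih, h3, h4, h1, h2]
    push_cast
    ring

theorem qNumber_sq_sub_qNumber_sq (hq : q ≠ 0) {s t : ℕ} (hs : 1 ≤ s) (hst : s < t) :
    qNumber q (2 * t - 1) ^ 2 - qNumber q (2 * s - 1) ^ 2 =
      q ^ (4 - 4 * (t : ℤ)) * (qInt (q ^ 2) (2 * (s + t - 1)) * qInt (q ^ 2) (2 * (t - s))) := by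
  have h1 := qNumber_natCast hq (2 * (s + t - 1))
  have h2 := qNumber_natCast hq (2 * (t - s))
  have e1 : ((2 * (s + t - 1) : ℕ) : ℤ) = 2 * t - 1 + (2 * s - 1) := by omega
  have e2 : ((2 * (t - s) : ℕ) : ℤ) = 2 * t - 1 - (2 * s - 1) := by omega
  rw [e1] at h1
  rw [e2] at h2
  rw [← qNumber_add_mul_qNumber_sub hq, h1, h2, show 4 - 4 * (t : ℤ) =
    1 - (2 * t - 1 + (2 * s - 1)) + (1 - (2 * t - 1 - (2 * s - 1))) by ring, zpow_add₀ hq]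
  ring

/-- For each `j`, the last `j` factors of `[2j]!` are the `[i+j+1]` with `i < j`, and the first `j`,
reversed, are the `[j-i]`. -/
theorem prod_qFactorial (q : K) (n : ℕ) :
    ∏ i : Fin n, qFactorial q (2 * (i : ℕ)) =
      (∏ i : Fin n, ∏ j ∈ Finset.Ioi i, qInt q ((i : ℕ) + (j : ℕ) + 1)) *
        ∏ i : Fin n, ∏ j ∈ Finset.Ioi i, qInt q ((j : ℕ) - (i : ℕ)) := by
  rw [Fin.prod_prod_Ioi_comm, Fin.prod_prod_Ioi_comm, ← Finset.prod_mul_distrib]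
  refine Finset.prod_congr rfl fun j _ => ?_
  rw [Fin.prod_Iio_val j fun i => qInt q (i + j + 1), Fin.prod_Iio_val j fun i => qInt q (j - i),
    qFactorial, two_mul, Finset.prod_range_add, mul_comm,
    ← Finset.prod_range_reflect (fun k => qInt q (k + 1))]
  congr 1
  · exact Finset.prod_congr rfl fun i _ => by rw [add_comm i]
  · refine Finset.prod_congr rfl fun i hi => ?_
    have := Finset.mem_range.1 hi
    congr 1
    omega

theorem tilingGF_quarteredHexagon (hq : q ≠ 0) (h2 : (2 : K) ≠ 0) (x n : ℕ) (s : Fin n → ℕ)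
    (hden : ∀ m : ℕ, 1 ≤ m → m ≤ 2 * n - 2 → qInt (q ^ 2) m ≠ 0)
    (hs : StrictMono s) (hs_range : ∀ i, 1 ≤ s i ∧ s i ≤ n + x) :
    tilingGF q (quarteredHexagon x s) =
      (2 : K) ^ (-((n : ℤ) * ((n : ℤ) - 1))) *
      q ^ (-∑ i : Fin n, ((i : ℕ) : ℤ) * (4 * (s i : ℤ) - 2 * (((i : ℕ) : ℤ) + 1) - 1)) *
      ((∏ i : Fin n, ∏ j ∈ Finset.Ioi i,
          qInt (q ^ 2) (2 * (s i + s j - 1)) * qInt (q ^ 2) (2 * (s j - s i))) /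
        ∏ i : Fin n, qFactorial (q ^ 2) (2 * (i : ℕ))) := by
  have hmono : StrictMono fun i => 2 * (s i : ℤ) - 1 := fun i j h => by
    have := hs h
    simp only
    omega
  rw [quarteredHexagon_eq_dentedTrapezoid, tilingGF_dentedTrapezoid_eq_det hq h2
    ⟨x + n - 1, by ring⟩ n (fun k h1 h2 => ?_) le_rfl Even.zero (by ring) hmono
    (fun i => ⟨s i - 1, by ring⟩) (fun i => by have := hs_range i; omega), det_oddProd]
  · have e1 : ∏ m ∈ Finset.range n, ∏ k ∈ Finset.range m,
        (4 * qNumber q (2 * k + 1) * qNumber q (2 * k + 2)) =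
        (2 : K) ^ ((n : ℤ) * ((n : ℤ) - 1)) *
          q ^ (∑ i : Fin n, -(((i : ℕ) : ℤ) * (2 * (i : ℕ) - 1))) *
          ∏ i : Fin n, qFactorial (q ^ 2) (2 * (i : ℕ)) := by
      have hsum : ∑ i : Fin n, (2 * (i : ℕ) : ℤ) = n * ((n : ℤ) - 1) := by
        clear hmono hden hs hs_range s
        induction n with
        | zero => simp
        | succ n ih =>
          rw [Fin.sum_univ_castSucc]
          simp only [Fin.val_castSucc, Fin.val_last, ih]
          push_cast; ring
      rw [← hsum, ← prod_zpow_eq_zpow_sum h2, ← prod_zpow_eq_zpow_sum hq,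
        ← Finset.prod_mul_distrib, ← Finset.prod_mul_distrib, Finset.prod_range]
      refine Finset.prod_congr rfl fun i _ => ?_
      rw [prod_qNumber_eq_qFactorial hq]
      congr 2
      exact_mod_cast (zpow_natCast (2 : K) (2 * (i : ℕ))).symm
    have e2 : ∏ i : Fin n, ∏ j ∈ Finset.Ioi i,
        (qNumber q (2 * (s j : ℤ) - 1) ^ 2 - qNumber q (2 * (s i : ℤ) - 1) ^ 2) =
        q ^ (∑ i : Fin n, ((i : ℕ) : ℤ) * (4 - 4 * (s i : ℤ))) *
        ∏ i : Fin n, ∏ j ∈ Finset.Ioi i,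
          qInt (q ^ 2) (2 * (s i + s j - 1)) * qInt (q ^ 2) (2 * (s j - s i)) := by
      have : ∏ i : Fin n, ∏ j ∈ Finset.Ioi i, q ^ (4 - 4 * (s j : ℤ)) =
          q ^ (∑ i : Fin n, ((i : ℕ) : ℤ) * (4 - 4 * (s i : ℤ))) := by
        rw [Fin.prod_prod_Ioi_comm, ← prod_zpow_eq_zpow_sum hq]
        refine Finset.prod_congr rfl fun j _ => ?_
        -- The factor depends only on the larger index `j`, which has `j` smaller partners.
        rw [Finset.prod_const, Fin.card_Iio, mul_comm ((j : ℕ) : ℤ), zpow_mul, zpow_natCast]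
      rw [← this, ← Finset.prod_mul_distrib]
      refine Finset.prod_congr rfl fun i _ => ?_
      rw [← Finset.prod_mul_distrib]
      exact Finset.prod_congr rfl fun j hj =>
        qNumber_sq_sub_qNumber_sq hq (hs_range i).1 (hs (Finset.mem_Ioi.1 hj))
    have e3 : -∑ i : Fin n, ((i : ℕ) : ℤ) * (4 * (s i : ℤ) - 2 * (((i : ℕ) : ℤ) + 1) - 1) =
        -(∑ i : Fin n, -(((i : ℕ) : ℤ) * (2 * (i : ℕ) - 1))) +
          ∑ i : Fin n, ((i : ℕ) : ℤ) * (4 - 4 * (s i : ℤ)) := by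
      rw [← Finset.sum_neg_distrib, ← Finset.sum_neg_distrib, ← Finset.sum_add_distrib]
      exact Finset.sum_congr rfl fun i _ => by ring
    rw [e1, e2, e3, zpow_add₀ hq, zpow_neg, zpow_neg, mul_inv, mul_inv, div_eq_mul_inv]
    ring
  · rw [qNumber_natCast hq]
    exact mul_ne_zero (zpow_ne_zero _ hq) (hden k h1 h2)

end

/-- The index `i : Fin n` stands for the index `i + 1` in `1, …, n`. -/
theorem mainTheorem3 {K : Type*} [Field K] (q : K) (x n : ℕ) (s : Fin n → ℕ)
    (h2 : (2 : K) ≠ 0) (hq : q ≠ 0)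
    (hden : ∀ m : ℕ, 1 ≤ m → m ≤ 2 * n - 2 → qInt (q ^ 2) m ≠ 0)
    (hs : StrictMono s) (hs_range : ∀ i, 1 ≤ s i ∧ s i ≤ n + x) :
    tilingGF q (quarteredHexagon x s) =
        (2 : K) ^ (-((n : ℤ) * ((n : ℤ) - 1))) *
        q ^ (-∑ i : Fin n, ((i : ℕ) : ℤ) * (4 * (s i : ℤ) - 2 * (((i : ℕ) : ℤ) + 1) - 1)) *
        ((∏ i : Fin n, ∏ j ∈ Finset.Ioi i,
            qInt (q ^ 2) (2 * (s i + s j - 1)) * qInt (q ^ 2) (2 * (s j - s i))) /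
          ∏ i : Fin n, qFactorial (q ^ 2) (2 * (i : ℕ))) ∧
    tilingGF q (quarteredHexagon x s) =
        (2 : K) ^ (-((n : ℤ) * ((n : ℤ) - 1))) *
        q ^ (-∑ i : Fin n, ((i : ℕ) : ℤ) * (4 * (s i : ℤ) - 2 * (((i : ℕ) : ℤ) + 1) - 1)) *
        (∏ i : Fin n, ∏ j ∈ Finset.Ioi i,
            qInt (q ^ 2) (2 * (s i + s j - 1)) / qInt (q ^ 2) ((i : ℕ) + (j : ℕ) + 1)) *
        ∏ i : Fin n, ∏ j ∈ Finset.Ioi i,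
            qInt (q ^ 2) (2 * (s j - s i)) / qInt (q ^ 2) ((j : ℕ) - (i : ℕ)) := by
  have key := tilingGF_quarteredHexagon hq h2 x n s hden hs hs_range
  refine ⟨key, key.trans ?_⟩
  rw [prod_qFactorial, mul_assoc (_ * _) (Finset.prod _ _) (Finset.prod _ _)]
  congr 1
  simp only [Finset.prod_mul_distrib, Finset.prod_div_distrib]
  rw [div_mul_div_comm]
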